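/- Work in max algebra: on $\mathbb{R}_{\ge 0}$ with $a\oplus b=\max(a,b)$ and the usual product, $(A\otimes B)_{i,j}=\max_l a_{i,l}b_{l,j}$, and let $a^{(t)}_{i,j}$ denote the entries of the $t$-th power $A^{\otimes t}$ ($A^{\otimes 0}$ being the identity matrix). Let $A$ be an $n\times n$ nonnegative matrix. Its digraph $\mathcal{D}(A)$ has nodes $1,\dots,n$ and an edge $(i,j)$ whenever $a_{i,j}\neq 0$; $A$ is irreducible if $\mathcal{D}(A)$ is strongly connected. Let $\lambda(A)$ be the maximum of $p(C)^{1/\ell(C)}$ over all nonempty cycles $C$ of $\mathcal{D}(A)$, where $p(C)$ is the product of the weights of the edges of $C$ and $\ell(C)$ is its length ($\lambda(A)=0$ if there are no such cycles). The cycles that attain this maximum, and all nodes and edges on them, are called critical; the critical graph consists of all critical nodes and edges. The transient of the $k$-th row of $A$ is the least $t\ge 0$ such that, for some $p>0$, $a^{(p+t)}_{k,i}=\lambda(A)^p\,a^{(t)}_{k,i}$ for all $i$; the transient of the $k$-th column is the least $t\ge 0$ such that, for some $p>0$, $a^{(p+t)}_{i,k}=\lambda(A)^p\,a^{(t)}_{i,k}$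 for all $i$. Put $\mathrm{Wi}(1)=0$ and $\mathrm{Wi}(m)=(m-1)^2+1$ for $m>1$. Let $k$ be a critical node, $H$ the strongly connected component of the critical graph that contains $k$, $|H|$ its number of nodes and $g(H)$ its girth (the smallest length of a nonempty cycle in $H$). Then the transients of the $k$-th row and of the $k$-th column of $A$ exist, whether or not $A$ is irreducible, and both are at most each of (i) $\mathrm{Wi}(n)$ (Wielandt bound; this is the conjecture of Sergeev and Schneider), (ii) $(n-2)\,g(H)+|H|$ (Dulmage–Mendelsohn bound). If moreover $A$ is irreducible and $d$ is the cyclicity of $\mathcal{D}(A)$ (the greatest common divisor of the lengths of its nonempty cycles), then both are also at most each of (iii) $d\cdot\mathrm{Wi}(\lfloor n/d\rfloor)+(n \bmod d)$ (Schwarz bound), (iv) $(\lfloor n/d\rfloor-2)\,g(H)+\min\bigl(n,\,|H|+(n \bmod d)\bigr)$ (Kim bound). -/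

import Mathlib

open scoped NNReal

/-! ### Walks, cycles, cyclicity, girth and strong components of a digraph -/

namespace Digraph

variable {V : Type*}

/-- `w = (w 0, …, w t)` is a walk of length `t` in `D` (for `t = 0`: an empty walk). -/
def IsWalk (D : Digraph V) {t : ℕ} (w : Fin (t + 1) → V) : Prop :=
  ∀ s : Fin t, D.Adj (w s.castSucc) (w s.succ)

/-- `w` is a nonempty cycle of length `t` in `D`: a closed walk of positive length in which
no node is repeated, except that the end node equals the start node. -/
def IsCycle (D : Digraph V) {t : ℕ} (w : Fin (t + 1) → V) : Prop :=
  0 < t ∧ D.IsWalk w ∧ w 0 = w (Fin.last t) ∧ Function.Injective fun s : Fin t => w s.castSucc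

/-- There is a walk in `D`, of some length `t ≥ 0`, from `i` to `j`. -/
def Reaches (D : Digraph V) (i j : V) : Prop :=
  ∃ (t : ℕ) (w : Fin (t + 1) → V), D.IsWalk w ∧ w 0 = i ∧ w (Fin.last t) = j

def StronglyConnected (D : Digraph V) : Prop :=
  ∀ i j : V, D.Reaches i j

/-- The set of lengths of the nonempty cycles of `D`. -/
def cycleLengths (D : Digraph V) : Set ℕ :=
  {t | ∃ w : Fin (t + 1) → V, D.IsCycle w}

/-- The greatest common divisor of the lengths of all nonempty cycles of `D`. -/
noncomputable def cyclicity (D : Digraph V) : ℕ :=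
  Nat.setGcd D.cycleLengths

/-- The smallest length of a nonempty cycle of `D`. -/
noncomputable def girth (D : Digraph V) : ℕ :=
  sInf D.cycleLengths

/-- The set of nodes of the strongly connected component of `D` containing `k`. -/
def componentNodes (D : Digraph V) (k : V) : Set V :=
  {j | D.Reaches k j ∧ D.Reaches j k}

/-- The strongly connected component of `D` containing `k`: the subgraph induced on
`D.componentNodes k` (all other elements of `V` carry no edges). -/
def component (D : Digraph V) (k : V) : Digraph V where
  Adj i j := i ∈ D.componentNodes k ∧ j ∈ D.componentNodes k ∧ D.Adj i j

end Digraph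

/-! ### Nonnegative matrices in max algebra -/

namespace MaxAlg

variable {n : ℕ}

/-- The max-algebraic product `(A ⊗ B) i j = max_k A i k * B k j`
(the supremum of the empty family is `0`). -/
noncomputable def mul (A B : Matrix (Fin n) (Fin n) ℝ≥0) : Matrix (Fin n) (Fin n) ℝ≥0 :=
  Matrix.of fun i j => Finset.univ.sup fun k => A i k * B k j

/-- The max-algebraic powers of `A`; the power of order `0` is the identity matrix. -/
noncomputable def pow (A : Matrix (Fin n) (Fin n) ℝ≥0) : ℕ → Matrix (Fin n) (Fin n) ℝ≥0
  | 0 => 1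
  | t + 1 => mul (pow A t) A

/-- The digraph of `A`: there is an edge `(i, j)` if and only if `A i j ≠ 0`. -/
def digraph (A : Matrix (Fin n) (Fin n) ℝ≥0) : Digraph (Fin n) where
  Adj i j := A i j ≠ 0

/-- `A` is irreducible if its digraph is strongly connected. -/
def IsIrreducible (A : Matrix (Fin n) (Fin n) ℝ≥0) : Prop :=
  (digraph A).StronglyConnected

/-- The weight of a walk: the product of the weights of its edges. -/
noncomputable def weight (A : Matrix (Fin n) (Fin n) ℝ≥0) {t : ℕ} (w : Fin (t + 1) → Fin n) :
    ℝ≥0 :=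
  ∏ s : Fin t, A (w s.castSucc) (w s.succ)

/-- The geometric mean `p(C) ^ (1 / ℓ(C))` of the weights of the edges of a walk. -/
noncomputable def geomMean (A : Matrix (Fin n) (Fin n) ℝ≥0) {t : ℕ} (w : Fin (t + 1) → Fin n) :
    ℝ≥0 :=
  weight A w ^ (1 / (t : ℝ))

/-- The maximum cycle geometric mean `λ(A)`. The set of which the supremum is taken is finite;
the supremum is `0` if there are no nonempty cycles. -/
noncomputable def maxCycleMean (A : Matrix (Fin n) (Fin n) ℝ≥0) : ℝ≥0 :=
  sSup {x | ∃ (t : ℕ) (w : Fin (t + 1) → Fin n), (digraph A).IsCycle w ∧ x = geomMean A w}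

/-- A critical cycle: a nonempty cycle at which the maximum cycle geometric mean is attained. -/
def IsCriticalCycle (A : Matrix (Fin n) (Fin n) ℝ≥0) {t : ℕ} (w : Fin (t + 1) → Fin n) : Prop :=
  (digraph A).IsCycle w ∧ geomMean A w = maxCycleMean A

/-- A critical node: a node that belongs to a critical cycle. -/
def IsCriticalNode (A : Matrix (Fin n) (Fin n) ℝ≥0) (k : Fin n) : Prop :=
  ∃ (t : ℕ) (w : Fin (t + 1) → Fin n), IsCriticalCycle A w ∧ ∃ s, w s = k

/-- The critical graph: its edges are the edges that belong to critical cycles (the elements of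
`Fin n` that are not critical nodes carry no edges). -/
def criticalGraph (A : Matrix (Fin n) (Fin n) ℝ≥0) : Digraph (Fin n) where
  Adj i j := ∃ (t : ℕ) (w : Fin (t + 1) → Fin n), IsCriticalCycle A w ∧
    ∃ s : Fin t, w s.castSucc = i ∧ w s.succ = j

/-- `T` is the transient of the `k`-th row of `A`. -/
def IsRowTransient (A : Matrix (Fin n) (Fin n) ℝ≥0) (k : Fin n) (T : ℕ) : Prop :=
  IsLeast {t : ℕ | ∃ p : ℕ, 0 < p ∧
    ∀ i, pow A (p + t) k i = maxCycleMean A ^ p * pow A t k i} T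

/-- `T` is the transient of the `k`-th column of `A`. -/
def IsColTransient (A : Matrix (Fin n) (Fin n) ℝ≥0) (k : Fin n) (T : ℕ) : Prop :=
  IsLeast {t : ℕ | ∃ p : ℕ, 0 < p ∧
    ∀ i, pow A (p + t) i k = maxCycleMean A ^ p * pow A t i k} T

/-- The Wielandt number: `0` for `m = 1` and `(m - 1) ^ 2 + 1` for `m > 1`. -/
def wielandt (m : ℕ) : ℕ :=
  if m ≤ 1 then 0 else (m - 1) ^ 2 + 1

/-- The number `|H|` of nodes of the component `H` of the critical graph containing `k`. -/
noncomputable def criticalSize (A : Matrix (Fin n) (Fin n) ℝ≥0) (k : Fin n) : ℕ :=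
  ((criticalGraph A).componentNodes k).ncard

/-- The girth `g(H)` of the component `H` of the critical graph containing `k`. -/
noncomputable def criticalGirth (A : Matrix (Fin n) (Fin n) ℝ≥0) (k : Fin n) : ℕ :=
  ((criticalGraph A).component k).girth

/-- The bounds of Wielandt and of Dulmage and Mendelsohn for a transient `T`. -/
def WielandtDMBounds (A : Matrix (Fin n) (Fin n) ℝ≥0) (k : Fin n) (T : ℕ) : Prop :=
  T ≤ wielandt n ∧
  (T : ℤ) ≤ ((n : ℤ) - 2) * (criticalGirth A k : ℤ) + (criticalSize A k : ℤ)

/-- The bounds of Schwarz and of Kim for a transient `T`, with `d` the cyclicity of the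
digraph of `A`; `n / d` is the integer part of the quotient. -/
def SchwarzKimBounds (A : Matrix (Fin n) (Fin n) ℝ≥0) (k : Fin n) (T : ℕ) : Prop :=
  T ≤ (digraph A).cyclicity * wielandt (n / (digraph A).cyclicity)
    + n % (digraph A).cyclicity ∧
  (T : ℤ) ≤ (((n / (digraph A).cyclicity : ℕ) : ℤ) - 2) * (criticalGirth A k : ℤ)
    + ((min n (criticalSize A k + n % (digraph A).cyclicity) : ℕ) : ℤ)

end MaxAlg

/-! Divide the powers by those of λ(A): closed walks then have weight at most 1, and critical cycles
weight exactly 1. Stability moves backwards along critical walks: if a critical walk of length s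
leads from k to k', and the row of k' is periodic from t on, then the row of k is periodic from s +
t on (`RowStable.transfer`). From k one follows a lasso, that is, a path of length s to a shortest
cycle of H (length g), then around that cycle; it has s + g ≤ |H| distinct nodes (`exists_lasso`).

Colour the nodes by their cyclic class mod d; the uncoloured case is d = 1. Let u < d and let m be
the size of the class met u steps after entering the cycle. On this class the g-th power has a loop
of weight 1, so m - 1 of its steps suffice, which gives stability from s + u + g(m - 1) on
(`RowStable.of_lasso`). Put q = ⌊n/d⌋ and r = n mod d. Either some class has fewer than q nodes, or
the first class of size q along the cycle has u ≤ r and s + g + u ≤ n, because each larger class met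
before it has a node off the lasso (`exists_small_class`). Both cases give Kim's bound, and
Dulmage–Mendelsohn's for d = 1.

Schwarz's bound follows from Kim's if g ≤ d(q - 1). Otherwise either Kim's case of a small class
applies, and a small class itself forces g ≤ d(q - 1), or g = dq and the cycle exhausts a class of
size q: the d-th power then has a Hamiltonian critical cycle on that class. After a diagonal scaling
its edges have weight 1 and all others at most 1. Give each edge its deviation from the cycle in
ℤ/q. A walk keeps its end nodes and its length mod q when its edges are thinned out to a zero-sum
free family and rejoined along the cycle. Such a family has at most q - 1 members, all equal in the
extremal case, which yields (q - 1)² + 1 (`IsPowerFamily.le_of_hamiltonian`).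

Everything is proved for abstract power families, since the argument passes to transposes, to powers
restricted to a class, and to diagonal scalings. -/

namespace MaxAlg

/-! ### Families of max-algebraic powers -/

section PowerFamily

variable {V : Type*}

/-- `F` behaves like the sequence of max-algebraic powers of a matrix indexed by `V`. -/
structure IsPowerFamily (F : ℕ → V → V → ℝ≥0) : Prop where
  zero_self : ∀ i, F 0 i i = 1
  zero_ne : ∀ i j, i ≠ j → F 0 i j = 0
  mul_le : ∀ s t i l j, F s i l * F t l j ≤ F (s + t) i j
  exists_le : ∀ s t i j, ∃ l, F (s + t) i j ≤ F s i l * F t l j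

variable {F : ℕ → V → V → ℝ≥0}

/-- Transposition: it turns column statements into row statements. -/
theorem IsPowerFamily.flip (hF : IsPowerFamily F) : IsPowerFamily fun t i j => F t j i where
  zero_self := hF.zero_self
  zero_ne i j h := hF.zero_ne j i h.symm
  mul_le s t i l j := by
    rw [mul_comm, add_comm]
    exact hF.mul_le t s j l i
  exists_le s t i j := by
    obtain ⟨l, hl⟩ := hF.exists_le t s j i
    exact ⟨l, by rwa [mul_comm, add_comm]⟩

theorem IsPowerFamily.exists_walk (hF : IsPowerFamily F) {t : ℕ} {i j : V} (h : F t i j ≠ 0) :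
    ∃ w : ℕ → V, w 0 = i ∧ w t = j ∧
      F t i j ≤ ∏ s ∈ Finset.range t, F 1 (w s) (w (s + 1)) := by
  induction t generalizing j with
  | zero =>
    have hij : i = j := by
      by_contra hne
      exact h (hF.zero_ne i j hne)
    subst hij
    exact ⟨fun _ => i, rfl, rfl, by simp [hF.zero_self]⟩
  | succ t ih =>
    obtain ⟨l, hl⟩ := hF.exists_le t 1 i j
    have hne : F t i l ≠ 0 := by
      intro h0
      rw [h0, zero_mul] at hl
      exact h (le_antisymm hl zero_le)
    obtain ⟨w, h0, ht, hw⟩ := ih hne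
    refine ⟨fun x => if x ≤ t then w x else j, by simpa using h0, by simp, ?_⟩
    rw [Finset.prod_range_succ]
    refine hl.trans (mul_le_mul' (hw.trans (le_of_eq ?_)) (by simp [ht]))
    refine Finset.prod_congr rfl fun x hx => ?_
    have hx' := Finset.mem_range.1 hx
    simp [hx'.le, Nat.succ_le_of_lt hx']

theorem IsPowerFamily.prod_Ico_le (hF : IsPowerFamily F) (w : ℕ → V) {a b : ℕ} (hab : a ≤ b) :
    ∏ s ∈ Finset.Ico a b, F 1 (w s) (w (s + 1)) ≤ F (b - a) (w a) (w b) := by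
  induction b, hab using Nat.le_induction with
  | base => simp [hF.zero_self]
  | succ b hab ih =>
    rw [Finset.prod_Ico_succ_top hab, Nat.sub_add_comm hab]
    exact (mul_le_mul' ih le_rfl).trans (hF.mul_le _ _ _ _ _)

/-- Cuts a walk at two nodes, either to excise a closed middle piece or to isolate one edge of a
cycle. -/
theorem IsPowerFamily.prod_range_le (hF : IsPowerFamily F) (w : ℕ → V) {a b t : ℕ}
    (hab : a ≤ b) (hbt : b ≤ t) :
    ∏ s ∈ Finset.range t, F 1 (w s) (w (s + 1)) ≤
      F a (w 0) (w a) * F (b - a) (w a) (w b) * F (t - b) (w b) (w t) := by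
  rw [Finset.range_eq_Ico, ← Finset.prod_Ico_consecutive _ (Nat.zero_le b) hbt,
    ← Finset.prod_Ico_consecutive _ (Nat.zero_le a) hab]
  exact mul_le_mul' (mul_le_mul' (hF.prod_Ico_le w (Nat.zero_le a)) (hF.prod_Ico_le w hab))
    (hF.prod_Ico_le w hbt)

theorem IsPowerFamily.one_le_loop (hF : IsPowerFamily F) {p : ℕ} {k : V} (h : 1 ≤ F p k k)
    (m : ℕ) : 1 ≤ F (m * p) k k := by
  induction m with
  | zero => simp [hF.zero_self]
  | succ m ih =>
    rw [Nat.succ_mul]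
    exact (one_le_mul ih h).trans (hF.mul_le _ _ _ _ _)

theorem IsPowerFamily.le_of_loop (hF : IsPowerFamily F) {p : ℕ} {k : V} (h : 1 ≤ F p k k)
    (t : ℕ) (i : V) : F t k i ≤ F (p + t) k i :=
  (le_mul_of_one_le_left zero_le h).trans (hF.mul_le _ _ _ _ _)

/-- If closed walks have weight at most `1` and there is a loop of weight `1` at `k`, then walks
from `k` need not be longer than the number of nodes minus one. -/
theorem IsPowerFamily.card_le_of_loop [Fintype V] (hF : IsPowerFamily F)
    (hd : ∀ t i, F t i i ≤ 1) {k : V} (hk : 1 ≤ F 1 k k) (i : V) :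
    F (Fintype.card V) k i ≤ F (Fintype.card V - 1) k i := by
  by_cases h : F (Fintype.card V) k i = 0
  · rw [h]; exact zero_le
  obtain ⟨w, h0, ht, hw⟩ := hF.exists_walk h
  obtain ⟨a, b, hab, hwab⟩ : ∃ a b : Fin (Fintype.card V + 1), a < b ∧ w a = w b := by
    obtain ⟨a, b, hne, hab⟩ := Fintype.exists_ne_map_eq_of_card_lt
      (fun x : Fin (Fintype.card V + 1) => w x) (by simp)
    rcases lt_or_gt_of_ne hne with h | h
    · exact ⟨a, b, h, hab⟩
    · exact ⟨b, a, h, hab.symm⟩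
  have hab' : (a : ℕ) < b := hab
  have hb : (b : ℕ) ≤ Fintype.card V := by omega
  have h1 := hw.trans (hF.prod_range_le w hab'.le hb)
  rw [h0, ht, ← hwab] at h1
  calc F (Fintype.card V) k i
      ≤ F a k (w a) * 1 * F (Fintype.card V - b) (w a) i :=
        h1.trans (mul_le_mul' (mul_le_mul' le_rfl (hd _ _)) le_rfl)
    _ ≤ F (a + (Fintype.card V - b)) k i := by
        rw [mul_one]; exact hF.mul_le _ _ _ _ _
    -- Loops at `k` replace all but one of the b - a steps cut out.
    _ ≤ F ((b - a - 1) * 1 + (a + (Fintype.card V - b))) k i :=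
        hF.le_of_loop (hF.one_le_loop hk _) _ _
    _ = _ := by congr 2; omega

/-! ### Critical connections and stabilization of rows -/

/-- There is an optimal connection of length `s` from `i` to `j` that extends to a closed walk of
weight (at least) `1`. -/
def CritReach (F : ℕ → V → V → ℝ≥0) (s : ℕ) (i j : V) : Prop :=
  ∃ r, 0 < r ∧ 1 ≤ F s i j * F r j i

/-- The `k`-th row of `F` is periodic from `t` on. -/
def RowStable (F : ℕ → V → V → ℝ≥0) (k : V) (t : ℕ) : Prop :=
  ∃ p, 0 < p ∧ ∀ i, F (p + t) k i = F t k i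

theorem CritReach.flip {s : ℕ} {i j : V} (h : CritReach F s i j) :
    CritReach (fun t i j => F t j i) s j i := h

theorem CritReach.trans (hF : IsPowerFamily F) {s t : ℕ} {i j l : V} (h₁ : CritReach F s i j)
    (h₂ : CritReach F t j l) : CritReach F (s + t) i l := by
  obtain ⟨r, hr, h⟩ := h₁
  obtain ⟨r', hr', h'⟩ := h₂
  refine ⟨r' + r, by omega, ?_⟩
  calc 1 ≤ (F s i j * F r j i) * (F t j l * F r' l j) := one_le_mul h h'
    _ = (F s i j * F t j l) * (F r' l j * F r j i) := by ring
    _ ≤ _ := mul_le_mul' (hF.mul_le _ _ _ _ _) (hF.mul_le _ _ _ _ _)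

theorem CritReach.self (hd : ∀ t i, F t i i ≤ 1) {s : ℕ} {i : V}
    (h : CritReach F s i i) : 1 ≤ F s i i := by
  obtain ⟨r, _, h⟩ := h
  exact h.trans (mul_le_of_le_one_right zero_le (hd _ _))

theorem CritReach.zero (hF : IsPowerFamily F) {s : ℕ} {i j : V}
    (h : CritReach F s i j) : CritReach F 0 i i := by
  obtain ⟨r, hr, h⟩ := h
  refine ⟨s + r, by omega, ?_⟩
  rw [hF.zero_self, one_mul]
  exact h.trans (hF.mul_le _ _ _ _ _)

/-- Along a sequence of critical edges all connections are critical. -/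
theorem CritReach.of_seq (hF : IsPowerFamily F) {v : ℕ → V} {e : ℕ}
    (hv : ∀ x, CritReach F e (v x) (v (x + 1))) (x y : ℕ) :
    CritReach F (e * y) (v x) (v (x + y)) := by
  induction y with
  | zero => exact (hv x).zero hF
  | succ y ih => exact ih.trans hF (hv (x + y))

/-- Splitting off the last steps of a walk shows that equality at `t` persists at every later time,
so it can be iterated. -/
theorem RowStable.mul (hF : IsPowerFamily F) {k : V} {t p : ℕ}
    (h : ∀ i, F (p + t) k i = F t k i) (N : ℕ) (i : V) : F (N * p + t) k i = F t k i := by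
  have step : ∀ s i, F (p + t + s) k i = F (t + s) k i := by
    intro s i
    apply le_antisymm
    · obtain ⟨l, hl⟩ := hF.exists_le (p + t) s k i
      rw [h] at hl
      exact hl.trans (hF.mul_le _ _ _ _ _)
    · obtain ⟨l, hl⟩ := hF.exists_le t s k i
      rw [← h] at hl
      exact hl.trans (hF.mul_le _ _ _ _ _)
  induction N with
  | zero => simp
  | succ N ih =>
    rw [← ih, show (N + 1) * p + t = p + t + N * p by ring, step, add_comm]

/-- Prefix a long walk from `k` by the closed critical walk through `k'`. Seen from `k'`, the
remainder has length `t` plus a multiple of `p` and may be shortened to `t`. The positive return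
length keeps the period positive even when `s = 0`. -/
theorem RowStable.transfer (hF : IsPowerFamily F) {k k' : V} {s t : ℕ}
    (hs : CritReach F s k k') (h : RowStable F k' t) : RowStable F k (s + t) := by
  obtain ⟨r, hr, hsr⟩ := hs
  obtain ⟨p, hp, h⟩ := h
  have hloop : 1 ≤ F (s + r) k k := hsr.trans (hF.mul_le _ _ _ _ _)
  -- The extra turn from `k'` makes m + 1 turns, which must be a multiple of `p`; the factor 2 keeps
  -- `m` positive when `p = 1`.
  obtain ⟨m, hm⟩ : ∃ m, 2 * p = m + 1 := ⟨2 * p - 1, by omega⟩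
  have hm0 : 0 < m := by omega
  refine ⟨m * (s + r), by positivity, fun i => le_antisymm ?_ ?_⟩
  · have h1 := RowStable.mul hF h (2 * (s + r)) i
    calc F (m * (s + r) + (s + t)) k i
        ≤ F s k k' * F r k' k * F (m * (s + r) + (s + t)) k i :=
          le_mul_of_one_le_left zero_le hsr
      _ = F s k k' * (F r k' k * F (m * (s + r) + (s + t)) k i) := mul_assoc _ _ _
      _ ≤ F s k k' * F (r + (m * (s + r) + (s + t))) k' i :=
          mul_le_mul' le_rfl (hF.mul_le _ _ _ _ _)
      _ = F s k k' * F t k' i := by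
          rw [← h1]
          congr 2
          have : 2 * (s + r) * p = (m + 1) * (s + r) := by rw [← hm]; ring
          rw [this]; ring
      _ ≤ _ := hF.mul_le _ _ _ _ _
  · exact hF.le_of_loop (hF.one_le_loop hloop m) _ _

/-! ### Colourings: cyclic classes -/

variable {d : ℕ} {c : V → ZMod d}

theorem IsPowerFamily.color_eq (hF : IsPowerFamily F)
    (hc : ∀ i j, F 1 i j ≠ 0 → c j = c i + 1) {t : ℕ} {i j : V} (h : F t i j ≠ 0) :
    c j = c i + t := by
  obtain ⟨w, h0, ht, hw⟩ := hF.exists_walk h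
  have hne : ∀ s ∈ Finset.range t, F 1 (w s) (w (s + 1)) ≠ 0 := by
    rw [← Finset.prod_ne_zero_iff]
    exact (lt_of_lt_of_le (pos_iff_ne_zero.2 h) hw).ne'
  have : ∀ s ≤ t, c (w s) = c i + s := by
    intro s hs
    induction s with
    | zero => simp [h0]
    | succ s ih =>
      rw [hc _ _ (hne s (Finset.mem_range.2 (by omega))), ih (by omega)]
      push_cast
      ring
  rw [← ht]
  exact this t le_rfl

/-- The powers of order `e * t`, restricted to a colour class, again form a power family if `e` is
divisible by the number of colours. -/
theorem IsPowerFamily.restrict (hF : IsPowerFamily F)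
    (hc : ∀ i j, F 1 i j ≠ 0 → c j = c i + 1) {e : ℕ} (he : d ∣ e) (a : ZMod d) :
    IsPowerFamily fun t (i j : {x // c x = a}) => F (e * t) i j where
  zero_self i := by simp [hF.zero_self]
  zero_ne i j h := by simpa using hF.zero_ne i j (fun h' => h (Subtype.ext h'))
  mul_le s t i l j := by
    rw [mul_add]
    exact hF.mul_le _ _ _ _ _
  exists_le s t i j := by
    obtain ⟨l, hl⟩ := hF.exists_le (e * s) (e * t) i j
    -- Either the product vanishes and any node of the class will do, or the colours force `l` into
    -- the class.
    by_cases hl0 : F (e * s) i l = 0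
    · rw [hl0, zero_mul] at hl
      refine ⟨i, ?_⟩
      rw [mul_add]
      exact hl.trans zero_le
    · refine ⟨⟨l, ?_⟩, by rwa [mul_add]⟩
      rw [hF.color_eq hc hl0, i.2, Nat.cast_mul, (ZMod.natCast_eq_zero_iff e d).2 he]
      simp

/-- Stability of the restriction to a colour class gives stability of the whole family. -/
theorem RowStable.of_restrict (hF : IsPowerFamily F)
    (hc : ∀ i j, F 1 i j ≠ 0 → c j = c i + 1) {e : ℕ} (he : d ∣ e) (he0 : 0 < e) {k : V} {t : ℕ}
    (h : RowStable (fun t (i j : {x // c x = c k}) => F (e * t) i j) ⟨k, rfl⟩ t) :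
    RowStable F k (e * t) := by
  obtain ⟨p, hp, h⟩ := h
  refine ⟨e * p, by positivity, fun i => ?_⟩
  rw [← mul_add]
  by_cases hi : c i = c k
  · exact h ⟨i, hi⟩
  · have hz : ∀ x, F (e * x) k i = 0 := by
      intro x
      by_contra hne
      apply hi
      rw [hF.color_eq hc hne, Nat.cast_mul, (ZMod.natCast_eq_zero_iff e d).2 he]
      simp
    rw [hz, hz]

/-- On the class of `k` the closed walk of length `e` becomes a loop of the `e`-step family, to
which `card_le_of_loop` applies. -/
theorem RowStable.of_cycle [Fintype V] (hF : IsPowerFamily F) (hd : ∀ t i, F t i i ≤ 1)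
    (hc : ∀ i j, F 1 i j ≠ 0 → c j = c i + 1) {e : ℕ} (he : d ∣ e) (he0 : 0 < e) {k : V}
    (hk : 1 ≤ F e k k) : RowStable F k (e * (Nat.card {x // c x = c k} - 1)) := by
  classical
  refine RowStable.of_restrict hF hc he he0 ⟨1, one_pos, fun i => ?_⟩
  have hF' := hF.restrict hc he (c k)
  have hpos : 0 < Fintype.card {x // c x = c k} := Fintype.card_pos_iff.2 ⟨⟨k, rfl⟩⟩
  have hk' : 1 ≤ (fun t (i j : {x // c x = c k}) => F (e * t) i j) 1 ⟨k, rfl⟩ ⟨k, rfl⟩ := by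
    simpa using hk
  rw [Nat.card_eq_fintype_card]
  apply le_antisymm
  · rw [Nat.add_sub_cancel' hpos]
    exact hF'.card_le_of_loop (fun t i => hd _ _) hk' i
  · exact hF'.le_of_loop hk' _ i

end PowerFamily

end MaxAlg

/-! ### Zero-sum free families -/

section ZeroSum

open Finset

variable {ι G : Type*} [AddCommGroup G] [DecidableEq G]

/-- The set of sums of subfamilies. -/
def subsetSums (x : ι → G) (J : Finset ι) : Finset G :=
  J.powerset.image fun K => ∑ s ∈ K, x s

theorem mem_subsetSums {x : ι → G} {J : Finset ι} {g : G} :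
    g ∈ subsetSums x J ↔ ∃ K ⊆ J, ∑ s ∈ K, x s = g := by
  simp [subsetSums]

variable [DecidableEq ι]

/-- If the set of sums did not grow, translation by `x e` would map it into, hence onto, itself.
Then 0 would be `x e` plus a subsum, contrary to zero-sum freeness. -/
theorem card_subsetSums_insert {x : ι → G} {J : Finset ι} {e : ι} (he : e ∉ J)
    (h : ∀ K ⊆ insert e J, K.Nonempty → ∑ s ∈ K, x s ≠ 0) :
    #(subsetSums x J) + 1 ≤ #(subsetSums x (insert e J)) := by
  have hsub : subsetSums x J ⊆ subsetSums x (insert e J) := by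
    intro g hg
    obtain ⟨K, hK, rfl⟩ := mem_subsetSums.1 hg
    exact mem_subsetSums.2 ⟨K, hK.trans (subset_insert _ _), rfl⟩
  refine Nat.succ_le_of_lt (card_lt_card ⟨hsub, fun hsup => ?_⟩)
  have hmap : (subsetSums x J).image (fun g => x e + g) = subsetSums x J := by
    refine eq_of_subset_of_card_le ?_ ?_
    · intro g hg
      obtain ⟨g', hg', rfl⟩ := mem_image.1 hg
      obtain ⟨K, hK, rfl⟩ := mem_subsetSums.1 hg'
      refine hsup (mem_subsetSums.2 ⟨insert e K, insert_subset_insert _ hK, ?_⟩)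
      exact sum_insert fun h => he (hK h)
    · rw [card_image_of_injective _ (add_right_injective _)]
  have h0 : (0 : G) ∈ (subsetSums x J).image (fun g => x e + g) := by
    rw [hmap]
    exact mem_subsetSums.2 ⟨∅, empty_subset _, sum_empty⟩
  obtain ⟨g, hg, h0⟩ := mem_image.1 h0
  obtain ⟨K, hK, rfl⟩ := mem_subsetSums.1 hg
  refine h (insert e K) (insert_subset_insert _ hK) (insert_nonempty _ _) ?_
  rw [sum_insert fun h => he (hK h)]
  exact h0

theorem card_subsetSums_union {x : ι → G} {J K : Finset ι} (hd : Disjoint J K)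
    (h : ∀ L ⊆ J ∪ K, L.Nonempty → ∑ s ∈ L, x s ≠ 0) :
    #(subsetSums x J) + #K ≤ #(subsetSums x (J ∪ K)) := by
  induction K using Finset.induction_on with
  | empty => simp
  | insert e K heK ih =>
    rw [disjoint_insert_right] at hd
    rw [union_insert] at h ⊢
    have := ih hd.2 fun L hL => h L (hL.trans (subset_insert _ _))
    have := card_subsetSums_insert (e := e) (by simp [hd.1, heK]) h
    rw [card_insert_of_notMem heK]
    omega

/-- A zero-sum free family has fewer members than the group has elements. -/
theorem card_lt_of_zeroSumFree [Fintype G] {x : ι → G} {J : Finset ι}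
    (h : ∀ L ⊆ J, L.Nonempty → ∑ s ∈ L, x s ≠ 0) : #J < Fintype.card G := by
  have h1 := card_subsetSums_union (x := x) (J := ∅) (K := J) (disjoint_empty_left _) (by simpa)
  have h2 : #(subsetSums x (∅ : Finset ι)) = 1 := by simp [subsetSums]
  have h3 := (subsetSums x (∅ ∪ J)).card_le_univ
  omega

/-- The members of a zero-sum free family of maximal size are all equal. -/
theorem eq_of_zeroSumFree [Fintype G] {x : ι → G} {J : Finset ι}
    (h : ∀ L ⊆ J, L.Nonempty → ∑ s ∈ L, x s ≠ 0) (hJ : Fintype.card G ≤ #J + 1) {e f : ι}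
    (he : e ∈ J) (hf : f ∈ J) : x e = x f := by
  by_contra hne
  have hef : e ≠ f := fun h => hne (by rw [h])
  have hsub : ({e, f} : Finset ι) ⊆ J := by
    intro y hy
    simp only [mem_insert, mem_singleton] at hy
    rcases hy with rfl | rfl <;> assumption
  have hJ' : {e, f} ∪ (J \ {e, f}) = J := union_sdiff_of_subset hsub
  have h1 := card_subsetSums_union (x := x) (J := {e, f}) (K := J \ {e, f}) disjoint_sdiff
    (by rwa [hJ'])
  have h2 := (subsetSums x ({e, f} ∪ J \ {e, f})).card_le_univ
  have h3 : #(J \ {e, f}) + 2 = #J := by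
    rw [← card_pair hef, card_sdiff_add_card_eq_card hsub]
  have he0 : x e ≠ 0 := by
    simpa using h {e} (by simpa) (singleton_nonempty e)
  have hf0 : x f ≠ 0 := by
    simpa using h {f} (by simpa) (singleton_nonempty f)
  have hef0 : x e + x f ≠ 0 := by
    simpa [sum_pair hef] using h {e, f} hsub (insert_nonempty _ _)
  -- Two unequal members already give four sums, one more than the general count allows for.
  have h4 : ({0, x e, x f, x e + x f} : Finset G) ⊆ subsetSums x {e, f} := by
    intro g hg
    simp only [mem_insert, mem_singleton] at hg
    rw [mem_subsetSums]
    rcases hg with rfl | rfl | rfl | rfl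
    · exact ⟨∅, by simp, by simp⟩
    · exact ⟨{e}, by simp, by simp⟩
    · exact ⟨{f}, by simp, by simp⟩
    · exact ⟨{e, f}, by simp, sum_pair hef⟩
  have h5 : #({0, x e, x f, x e + x f} : Finset G) = 4 := by
    rw [card_insert_of_notMem, card_insert_of_notMem, card_insert_of_notMem, card_singleton]
    · simpa using he0
    · simp [hne, hf0]
    · simp only [mem_insert, mem_singleton, not_or]
      exact ⟨he0.symm, hf0.symm, hef0.symm⟩
  have h6 := card_le_card h4
  omega

/-- Every sum is also the sum of a zero-sum free subfamily. -/
theorem exists_zeroSumFree (x : ι → G) (I : Finset ι) :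
    ∃ J ⊆ I, ∑ s ∈ J, x s = ∑ s ∈ I, x s ∧ ∀ L ⊆ J, L.Nonempty → ∑ s ∈ L, x s ≠ 0 := by
  induction I using Finset.strongInduction with
  | H I ih =>
    by_cases h : ∀ L ⊆ I, L.Nonempty → ∑ s ∈ L, x s ≠ 0
    · exact ⟨I, Subset.rfl, rfl, h⟩
    · push Not at h
      obtain ⟨L, hL, hne, h0⟩ := h
      obtain ⟨J, hJ, hs, hz⟩ := ih (I \ L) (sdiff_ssubset hL hne)
      refine ⟨J, hJ.trans sdiff_subset, ?_, hz⟩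
      rw [hs, ← sum_sdiff hL, h0, add_zero]

end ZeroSum

/-! ### The case of a Hamiltonian critical cycle -/

namespace MaxAlg

section Hamiltonian

variable {q : ℕ} {G : ℕ → ZMod q → ZMod q → ℝ≥0}

theorem IsPowerFamily.one_le_forward (hG : IsPowerFamily G) (h1 : ∀ x, 1 ≤ G 1 x (x + 1))
    (x : ZMod q) (m : ℕ) : 1 ≤ G m x (x + m) := by
  induction m with
  | zero => simp [hG.zero_self]
  | succ m ih =>
    have := (one_le_mul ih (h1 (x + m))).trans (hG.mul_le _ _ _ _ _)
    rwa [Nat.cast_succ, ← add_assoc]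

/-- It suffices to find a walk with length in the right residue class. -/
theorem IsPowerFamily.le_of_cast_eq (hG : IsPowerFamily G) (h1 : ∀ x, 1 ≤ G 1 x (x + 1))
    {L t : ℕ} (hL : (L : ZMod q) = t) (hlt : L < t + q) (i j : ZMod q) : G L i j ≤ G t i j := by
  have hle : L ≤ t := by
    by_contra hcon
    have hm : L ≡ t [MOD q] := (ZMod.natCast_eq_natCast_iff _ _ _).1 hL
    have := (Nat.modEq_iff_dvd' (not_le.1 hcon).le).1 hm.symm
    have := Nat.le_of_dvd (by omega) this
    omega
  have := hG.le_of_loop (p := t - L) (k := i) ?_ L j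
  · rwa [Nat.sub_add_cancel hle] at this
  · have h := hG.one_le_forward h1 i (t - L)
    rwa [Nat.cast_sub hle, hL, sub_self, add_zero] at h

variable [NeZero q]

theorem IsPowerFamily.one_le_val (hG : IsPowerFamily G) (h1 : ∀ x, 1 ≤ G 1 x (x + 1))
    (x y : ZMod q) : 1 ≤ G (y - x).val x y := by
  simpa using hG.one_le_forward h1 x (y - x).val

/-- A set `J` of edges (in any order) can be completed to a walk by running along the cycle. -/
theorem IsPowerFamily.exists_through (hG : IsPowerFamily G) (h1 : ∀ x, 1 ≤ G 1 x (x + 1))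
    {ι : Type*} [DecidableEq ι] (a b : ι → ZMod q) (J : Finset ι) (i j : ZMod q) :
    ∃ L, L ≤ J.card * q + (q - 1) ∧ (L : ZMod q) = j - i - ∑ s ∈ J, (b s - a s - 1) ∧
      ∏ s ∈ J, G 1 (a s) (b s) ≤ G L i j := by
  induction J using Finset.induction_on generalizing i with
  | empty =>
    have := ZMod.val_lt (j - i)
    exact ⟨(j - i).val, by simp; omega, by simp, by simpa using hG.one_le_val h1 i j⟩
  | insert e J he ih =>
    obtain ⟨L, hL, hLc, hw⟩ := ih (b e)
    have := ZMod.val_lt (a e - i)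
    refine ⟨(a e - i).val + 1 + L, ?_, ?_, ?_⟩
    · rw [Finset.card_insert_of_notMem he, Nat.succ_mul]
      omega
    · rw [Finset.sum_insert he]
      push_cast
      rw [ZMod.natCast_zmod_val, hLc]
      ring
    · rw [Finset.prod_insert he]
      calc G 1 (a e) (b e) * ∏ s ∈ J, G 1 (a s) (b s)
          ≤ (G (a e - i).val i (a e) * G 1 (a e) (b e)) * G L (b e) j :=
            mul_le_mul' (le_mul_of_one_le_left zero_le (hG.one_le_val h1 _ _)) hw
        _ ≤ _ := (mul_le_mul' (hG.mul_le _ _ _ _ _) le_rfl).trans (hG.mul_le _ _ _ _ _)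

/-- A single edge can be used repeatedly. -/
theorem IsPowerFamily.pow_edge_le (hG : IsPowerFamily G) (h1 : ∀ x, 1 ≤ G 1 x (x + 1))
    (a b j : ZMod q) (m : ℕ) :
    G 1 a b ^ (m + 1) ≤ G (m * ((a - b).val + 1) + 1 + (j - b).val) a j := by
  induction m with
  | zero =>
    simp only [zero_add, pow_one, zero_mul]
    exact (le_mul_of_one_le_right zero_le (hG.one_le_val h1 b j)).trans (hG.mul_le _ _ _ _ _)
  | succ m ih =>
    rw [pow_succ']
    calc G 1 a b * G 1 a b ^ (m + 1)
        ≤ (G 1 a b * G (a - b).val b a) *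
            G (m * ((a - b).val + 1) + 1 + (j - b).val) a j :=
          mul_le_mul' (le_mul_of_one_le_right zero_le (hG.one_le_val h1 _ _)) ih
      _ ≤ _ := (mul_le_mul' (hG.mul_le _ _ _ _ _) le_rfl).trans (hG.mul_le _ _ _ _ _)
      _ = _ := by congr 1; ring

/-- An edge deviates from the cycle by `w (s + 1) - w s - 1`, and the end nodes and total deviation
determine the length mod `q`. It is enough to find a walk of no smaller weight, in the right residue
class, of length below (q - 1)² + 1 + q. -/
theorem IsPowerFamily.le_of_hamiltonian (hG : IsPowerFamily G) (h1 : ∀ x, 1 ≤ G 1 x (x + 1))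
    (hle : ∀ t x y, G t x y ≤ 1) (hq : 2 ≤ q) (i j : ZMod q) :
    G (q + ((q - 1) ^ 2 + 1)) i j ≤ G ((q - 1) ^ 2 + 1) i j := by
  by_cases h0 : G (q + ((q - 1) ^ 2 + 1)) i j = 0
  · rw [h0]; exact zero_le
  obtain ⟨w, hw0, hwt, hw⟩ := hG.exists_walk h0
  have htot : ∑ s ∈ Finset.range (q + ((q - 1) ^ 2 + 1)), (w (s + 1) - w s - 1) =
      j - i - (((q - 1) ^ 2 + 1 : ℕ) : ZMod q) := by
    rw [Finset.sum_sub_distrib, Finset.sum_range_sub, hw0, hwt]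
    simp
  obtain ⟨J, hJ, hJs, hJz⟩ := exists_zeroSumFree (fun s => w (s + 1) - w s - 1)
    (Finset.range (q + ((q - 1) ^ 2 + 1)))
  rw [htot] at hJs
  have hwJ : G (q + ((q - 1) ^ 2 + 1)) i j ≤ ∏ s ∈ J, G 1 (w s) (w (s + 1)) := by
    refine hw.trans ?_
    rw [← Finset.prod_sdiff hJ]
    exact mul_le_of_le_one_left zero_le (Finset.prod_le_one' fun _ _ => hle _ _ _)
  refine hwJ.trans ?_
  have hcard := card_lt_of_zeroSumFree hJz
  rw [ZMod.card] at hcard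
  obtain ⟨p, rfl⟩ : ∃ p, q = p + 2 := ⟨q - 2, by omega⟩
  rw [show p + 2 - 1 = p + 1 by omega] at *
  rcases Nat.lt_or_ge (J.card + 1) (p + 2) with hlt | hge
  -- At most q - 2 edges, joined along the cycle, give length at most (q - 2)q + (q - 1), which is
  -- small enough.
  · obtain ⟨L, hL, hLc, hLw⟩ := hG.exists_through h1 w (fun s => w (s + 1)) J i j
    refine hLw.trans (hG.le_of_cast_eq h1 ?_ ?_ i j)
    · rw [hLc, hJs]; ring
    · have : J.card * (p + 2) ≤ p * (p + 2) := Nat.mul_le_mul_right _ (by omega)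
      rw [show p + 2 - 1 = p + 1 by omega] at hL
      nlinarith
  -- Extremal case: all deviations agree, so the heaviest edge repeated q - 1 times has the same
  -- total deviation and no less weight.
  · have hJc : J.card = p + 1 := by omega
    have hne : J.Nonempty := Finset.card_pos.1 (by omega)
    obtain ⟨e, he, hmax⟩ := Finset.exists_max_image J (fun s => G 1 (w s) (w (s + 1))) hne
    have heq : ∀ s ∈ J, w (s + 1) - w s - 1 = w (e + 1) - w e - 1 := fun s hs =>
      eq_of_zeroSumFree hJz (by rw [ZMod.card]; omega) hs he
    have he0 : w (e + 1) - w e - 1 ≠ 0 := by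
      simpa using hJz {e} (by simpa) (Finset.singleton_nonempty e)
    have hJs' : ((p + 1 : ℕ) : ZMod (p + 2)) * (w (e + 1) - w e - 1) =
        j - i - (((p + 1) ^ 2 + 1 : ℕ) : ZMod (p + 2)) := by
      rw [← hJs, Finset.sum_congr rfl heq, Finset.sum_const, hJc, nsmul_eq_mul]
    have hprod : ∏ s ∈ J, G 1 (w s) (w (s + 1)) ≤ G 1 (w e) (w (e + 1)) ^ (p + 1) := by
      rw [← hJc, ← Finset.prod_const]
      exact Finset.prod_le_prod' hmax
    -- A return of length q - 1 would mean zero deviation. The gain of one step per repetition keeps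
    -- the length within the limit.
    have hval : (w e - w (e + 1)).val ≤ p := by
      have hlt := ZMod.val_lt (w e - w (e + 1))
      by_contra hcon
      have hv : (w e - w (e + 1)).val = p + 1 := by omega
      apply he0
      have hc : ((p + 1 : ℕ) : ZMod (p + 2)) = w e - w (e + 1) := by
        rw [← hv, ZMod.natCast_zmod_val]
      have hz : ((p + 2 : ℕ) : ZMod (p + 2)) = 0 := ZMod.natCast_self _
      push_cast at hc hz
      linear_combination hc - hz
    have ha := ZMod.val_lt (w e - i)
    have hb := ZMod.val_lt (j - w (e + 1))
    calc _ ≤ G 1 (w e) (w (e + 1)) ^ (p + 1) := hprod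
      _ ≤ G (w e - i).val i (w e) * G (p * ((w e - w (e + 1)).val + 1) + 1 +
            (j - w (e + 1)).val) (w e) j :=
          (hG.pow_edge_le h1 _ _ j p).trans
            (le_mul_of_one_le_left zero_le (hG.one_le_val h1 _ _))
      _ ≤ _ := hG.mul_le _ _ _ _ _
      _ ≤ _ := by
          refine hG.le_of_cast_eq h1 ?_ ?_ i j
          · push_cast at hJs' ⊢
            simp only [ZMod.natCast_zmod_val]
            linear_combination -hJs'
          · have : p * ((w e - w (e + 1)).val + 1) ≤ p * (p + 1) :=
              Nat.mul_le_mul_left _ (by omega)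
            nlinarith

end Hamiltonian

variable {V : Type*} {F : ℕ → V → V → ℝ≥0}

/-- If there is a Hamiltonian critical cycle, of length at least `2`, then all rows are stable
from the Wielandt number on. -/
theorem RowStable.of_hamiltonian (hF : IsPowerFamily F) (hd : ∀ t i, F t i i ≤ 1) {q : ℕ}
    (hq : 2 ≤ q) {z : ZMod q → V} (hz : Function.Bijective z)
    (hcrit : ∀ x, CritReach F 1 (z x) (z (x + 1))) (k : V) :
    RowStable F k ((q - 1) ^ 2 + 1) := by
  have : NeZero q := ⟨by omega⟩
  have hcrit' : ∀ m : ℕ, CritReach F m (z 0) (z m) := by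
    intro m
    induction m with
    | zero => simpa using (hcrit 0).zero hF
    | succ m ih => simpa using ih.trans hF (hcrit m)
  -- potentials: weights of critical walks from a fixed root
  set π : ZMod q → ℝ≥0 := fun x => F x.val (z 0) (z x) with hπ
  have hπr : ∀ x, ∃ r, 1 ≤ π x * F r (z x) (z 0) := by
    intro x
    obtain ⟨r, -, h⟩ := hcrit' x.val
    rw [ZMod.natCast_zmod_val] at h
    exact ⟨r, h⟩
  have hπ0 : ∀ x, π x ≠ 0 := by
    intro x h0
    obtain ⟨r, h⟩ := hπr x
    simp [h0] at h
  -- The walk from `x` to `y` is completed to a closed walk through the root, of weight at most 1.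
  have hπle : ∀ x y s, F s (z x) (z y) * π x / π y ≤ 1 := by
    intro x y s
    rw [div_le_iff₀ (pos_iff_ne_zero.2 (hπ0 y)), one_mul]
    obtain ⟨r, h⟩ := hπr y
    calc F s (z x) (z y) * π x ≤ (π x * F s (z x) (z y)) * (π y * F r (z y) (z 0)) := by
          rw [mul_comm]; exact le_mul_of_one_le_right zero_le h
      _ = π y * ((π x * F s (z x) (z y)) * F r (z y) (z 0)) := by ring
      _ ≤ π y * 1 := mul_le_mul' le_rfl (((mul_le_mul' (hF.mul_le _ _ _ _ _) le_rfl).trans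
          (hF.mul_le _ _ _ _ _)).trans (hd _ _))
      _ = π y := mul_one _
  have hG : IsPowerFamily fun t x y => F t (z x) (z y) * π x / π y :=
    { zero_self := fun x => by rw [hF.zero_self, one_mul, div_self (hπ0 x)]
      zero_ne := fun x y h => by simp [hF.zero_ne _ _ (hz.1.ne h)]
      mul_le := fun s t i l j => by
        have : F s (z i) (z l) * π i / π l * (F t (z l) (z j) * π l / π j) =
            (F s (z i) (z l) * F t (z l) (z j)) * π i / π j := by
          have := hπ0 l
          field_simp
        rw [this]
        gcongr
        exact hF.mul_le _ _ _ _ _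
      exists_le := fun s t i j => by
        obtain ⟨l, hl⟩ := hF.exists_le s t (z i) (z j)
        obtain ⟨l, rfl⟩ := hz.2 l
        refine ⟨l, ?_⟩
        have : F s (z i) (z l) * π i / π l * (F t (z l) (z j) * π l / π j) =
            (F s (z i) (z l) * F t (z l) (z j)) * π i / π j := by
          have := hπ0 l
          field_simp
        rw [this]
        gcongr }
  have hG1 : ∀ x, 1 ≤ F 1 (z x) (z (x + 1)) * π x / π (x + 1) := by
    intro x
    rw [le_div_iff₀ (pos_iff_ne_zero.2 (hπ0 _)), one_mul]
    obtain ⟨r, h⟩ := hπr x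
    obtain ⟨r', -, h'⟩ := hcrit x
    calc π (x + 1) ≤ π (x + 1) *
          ((π x * F r (z x) (z 0)) * (F 1 (z x) (z (x + 1)) * F r' (z (x + 1)) (z x))) :=
          le_mul_of_one_le_right zero_le (one_le_mul h h')
      _ = (F 1 (z x) (z (x + 1)) * π x) *
          (π (x + 1) * (F r' (z (x + 1)) (z x) * F r (z x) (z 0))) := by ring
      _ ≤ (F 1 (z x) (z (x + 1)) * π x) * 1 := mul_le_mul' le_rfl
          ((mul_le_mul' le_rfl (hF.mul_le _ _ _ _ _)).trans
            ((hF.mul_le _ _ _ _ _).trans (hd _ _)))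
      _ = _ := mul_one _
  refine ⟨q, by omega, fun i => ?_⟩
  obtain ⟨x, rfl⟩ := hz.2 k
  obtain ⟨y, rfl⟩ := hz.2 i
  have hxy : π x / π y ≠ 0 := div_ne_zero (hπ0 x) (hπ0 y)
  have key : F (q + ((q - 1) ^ 2 + 1)) (z x) (z y) * (π x / π y) =
      F ((q - 1) ^ 2 + 1) (z x) (z y) * (π x / π y) := by
    rw [← mul_div_assoc, ← mul_div_assoc]
    refine le_antisymm (hG.le_of_hamiltonian hG1 (fun t x y => hπle x y t) hq x y) ?_
    have h := hG.one_le_forward hG1 x q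
    rw [ZMod.natCast_self, add_zero] at h
    exact hG.le_of_loop h _ y
  exact mul_right_cancel₀ hxy key

end MaxAlg

namespace MaxAlg

/-! ### Lassos in a strong component -/

section Lasso

variable {V : Type*} {E : V → V → Prop}

/-- `x` is connected to the set `Z` by a walk of length `t`. -/
def ReachesIn (E : V → V → Prop) (Z : Set V) : ℕ → V → Prop
  | 0, x => x ∈ Z
  | t + 1, x => ∃ y, E x y ∧ ReachesIn E Z t y

theorem exists_reachesIn {Z : Set V} {x y : V} (h : Relation.ReflTransGen E x y) (hy : y ∈ Z) :
    ∃ t, ReachesIn E Z t x := by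
  induction h using Relation.ReflTransGen.head_induction_on with
  | refl => exact ⟨0, hy⟩
  | head h _ ih =>
    obtain ⟨t, ht⟩ := ih
    exact ⟨t + 1, _, h, ht⟩

theorem cycle_add_mul {z : ℕ → V} {g : ℕ} (hper : ∀ x, z (x + g) = z x) (x m : ℕ) :
    z (x + m * g) = z x := by
  induction m with
  | zero => simp
  | succ m ih => rw [Nat.succ_mul, ← add_assoc, hper, ih]

theorem reflTransGen_of_cycle {z : ℕ → V} {g : ℕ} (hg : 0 < g) (hz : ∀ x, E (z x) (z (x + 1)))
    (hper : ∀ x, z (x + g) = z x) (x y : ℕ) : Relation.ReflTransGen E (z x) (z y) := by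
  have h : ∀ m, Relation.ReflTransGen E (z x) (z (x + m)) := by
    intro m
    induction m with
    | zero => exact .refl
    | succ m ih => exact ih.tail (hz _)
  have h' := h (y + x * g - x)
  rwa [Nat.add_sub_cancel' ((Nat.le_mul_of_pos_right x hg).trans (Nat.le_add_left _ _)),
    cycle_add_mul hper] at h'

/-- From every node of a strong component one can go to a given cycle `z` of the component and
then run along it, without visiting more than `|H|` nodes. -/
theorem exists_lasso [Finite V] {k : V} {z : ℕ → V} {g : ℕ} (hg : 0 < g)
    (hz : ∀ x, E (z x) (z (x + 1))) (hper : ∀ x, z (x + g) = z x)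
    (hinj : Set.InjOn z (Set.Iio g)) (hkz : Relation.ReflTransGen E k (z 0))
    (hzk : Relation.ReflTransGen E (z 0) k) :
    ∃ (v : ℕ → V) (s : ℕ), v 0 = k ∧ (∀ x, E (v x) (v (x + 1))) ∧
      (∀ x, v (s + g + x) = v (s + x)) ∧ Set.InjOn v (Set.Iio (s + g)) ∧
      s + g ≤ {x | Relation.ReflTransGen E k x ∧ Relation.ReflTransGen E x k}.ncard := by
  classical
  set S : Set V := {x | Relation.ReflTransGen E k x ∧ Relation.ReflTransGen E x k} with hS
  have hmod : ∀ x, z (x % g) = z x := by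
    intro x
    conv_rhs => rw [← Nat.mod_add_div' x g]
    exact (cycle_add_mul hper _ _).symm
  have hzz := reflTransGen_of_cycle hg hz hper
  have hzS : ∀ x, z x ∈ S := fun x => ⟨hkz.trans (hzz 0 x), (hzz x 0).trans hzk⟩
  set D : V → ℕ := fun x => sInf {t | ReachesIn E (Set.range z) t x} with hD
  have hDspec : ∀ x ∈ S, ReachesIn E (Set.range z) (D x) x := by
    intro x hx
    exact Nat.sInf_mem (s := {t | ReachesIn E (Set.range z) t x})
      (exists_reachesIn (hx.2.trans hkz) ⟨0, rfl⟩)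
  have hDle : ∀ x t, ReachesIn E (Set.range z) t x → D x ≤ t := fun x t h => Nat.sInf_le h
  -- One successor map serves for the whole lasso: on the cycle it follows `z`, elsewhere it
  -- decreases the distance `D` to the cycle.
  have hstep : ∀ x : V, ∃ y, (x ∈ S → D x ≠ 0 → E x y ∧ y ∈ S ∧ D y + 1 = D x) ∧
      ∀ m, x = z m → y = z (m + 1) := by
    intro x
    by_cases hxz : x ∈ Set.range z
    · obtain ⟨m, rfl⟩ := hxz
      refine ⟨z (m + 1), fun _ h0 => absurd (hDle (z m) 0 ⟨m, rfl⟩) (by omega), fun m' hm => ?_⟩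
      rw [← hmod m, ← hmod m'] at hm
      have := hinj (Nat.mod_lt _ hg) (Nat.mod_lt _ hg) hm
      rw [← hmod (m + 1), ← hmod (m' + 1), Nat.add_mod, this, ← Nat.add_mod]
    · by_cases hxS : x ∈ S
      · have h := hDspec x hxS
        obtain h0 | ⟨t, ht⟩ : D x = 0 ∨ ∃ t, D x = t + 1 :=
          (Nat.eq_zero_or_eq_succ_pred _).imp id fun h => ⟨_, h⟩
        · rw [h0] at h
          exact absurd h hxz
        · rw [ht] at h
          obtain ⟨y, hxy, hy⟩ := h
          have hyk : Relation.ReflTransGen E y k := by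
            clear ht hxy
            induction t generalizing y with
            | zero =>
              obtain ⟨m, rfl⟩ := hy
              exact (hzS m).2
            | succ t ih =>
              obtain ⟨y', hyy', hy'⟩ := hy
              exact .head hyy' (ih y' hy')
          refine ⟨y, fun _ _ => ⟨hxy, ⟨hxS.1.tail hxy, hyk⟩, ?_⟩,
            fun m hm => absurd ⟨m, hm.symm⟩ hxz⟩
          have h1 := hDle y t hy
          have h2 := hDle x (D y + 1) ⟨y, hxy, hDspec y ⟨hxS.1.tail hxy, hyk⟩⟩
          omega
      · exact ⟨x, fun h => absurd h hxS, fun m hm => absurd ⟨m, hm.symm⟩ hxz⟩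
  choose f hf hfz using hstep
  have hkS : k ∈ S := ⟨.refl, .refl⟩
  have hpre : ∀ x ≤ D k, f^[x] k ∈ S ∧ D (f^[x] k) + x = D k := by
    intro x hx
    induction x with
    | zero => exact ⟨hkS, rfl⟩
    | succ x ih =>
      obtain ⟨h1, h2⟩ := ih (by omega)
      obtain ⟨-, h3, h4⟩ := hf (f^[x] k) h1 (by omega)
      rw [Function.iterate_succ_apply']
      exact ⟨h3, by omega⟩
  obtain ⟨m, hm⟩ : ∃ m, z m = f^[D k] k := by
    obtain ⟨h1, h2⟩ := hpre (D k) le_rfl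
    have h3 := hDspec _ h1
    rw [show D (f^[D k] k) = 0 by omega] at h3
    exact h3
  have hpost : ∀ x, f^[D k + x] k = z (m + x) := by
    intro x
    induction x with
    | zero => exact hm.symm
    | succ x ih =>
      rw [← add_assoc, Function.iterate_succ_apply']
      exact hfz _ _ ih
  have hmemS : ∀ x, f^[x] k ∈ S := by
    intro x
    rcases le_total x (D k) with h | h
    · exact (hpre x h).1
    · obtain ⟨y, rfl⟩ := Nat.exists_eq_add_of_le h
      rw [hpost]
      exact hzS _
  -- `D` separates the nodes of the tail from each other and from the cycle, where it is 0.
  have hinjv : Set.InjOn (fun x => f^[x] k) (Set.Iio (D k + g)) := by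
    have hD0 : ∀ x, D (z x) = 0 := fun x => Nat.le_zero.1 (hDle (z x) 0 ⟨x, rfl⟩)
    intro x hx y hy hxy
    simp only [Set.mem_Iio] at hx hy hxy
    rcases lt_or_ge x (D k) with hxk | hxk <;> rcases lt_or_ge y (D k) with hyk | hyk
    · have h1 := (hpre x hxk.le).2
      have h2 := (hpre y hyk.le).2
      rw [hxy] at h1
      omega
    · obtain ⟨y, rfl⟩ := Nat.exists_eq_add_of_le hyk
      have h1 := (hpre x hxk.le).2
      rw [hxy, hpost, hD0] at h1
      omega
    · obtain ⟨x, rfl⟩ := Nat.exists_eq_add_of_le hxk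
      have h1 := (hpre y hyk.le).2
      rw [← hxy, hpost, hD0] at h1
      omega
    · obtain ⟨x, rfl⟩ := Nat.exists_eq_add_of_le hxk
      obtain ⟨y, rfl⟩ := Nat.exists_eq_add_of_le hyk
      rw [hpost, hpost, ← hmod (m + x), ← hmod (m + y)] at hxy
      have h1 : m + x ≡ m + y [MOD g] := hinj (Nat.mod_lt _ hg) (Nat.mod_lt _ hg) hxy
      have h2 : x ≡ y [MOD g] := Nat.ModEq.add_left_cancel' m h1
      rw [Nat.ModEq.eq_of_lt_of_lt h2 (by omega) (by omega)]
  refine ⟨fun x => f^[x] k, D k, rfl, fun x => ?_, fun x => ?_, hinjv, ?_⟩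
  · rcases lt_or_ge x (D k) with h | h
    · obtain ⟨h1, h2⟩ := hpre x h.le
      simp only [Function.iterate_succ_apply']
      exact (hf _ h1 (by omega)).1
    · obtain ⟨y, rfl⟩ := Nat.exists_eq_add_of_le h
      simp only [add_assoc, hpost]
      exact hz _
  · simp only [add_assoc, hpost]
    rw [← hper (m + x)]
    congr 1
    ring
  · have h1 : ((fun x => f^[x] k) '' Set.Iio (D k + g)).ncard = D k + g := by
      rw [hinjv.ncard_image]
      simp [Set.ncard_eq_toFinset_card']
    rw [← h1]
    refine Set.ncard_le_ncard ?_ (Set.toFinite _)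
    rintro _ ⟨x, -, rfl⟩
    exact hmemS x

end Lasso

/-! ### Stability times along a lasso -/

section Core

open Finset

variable {V : Type*} [Fintype V] {F : ℕ → V → V → ℝ≥0} {d : ℕ} {c : V → ZMod d}
  {v : ℕ → V} {s g : ℕ}

/-- Walking along the lasso to a colour class and stabilizing there. -/
theorem RowStable.of_lasso (hF : IsPowerFamily F) (hd : ∀ t i, F t i i ≤ 1)
    (hc : ∀ i j, F 1 i j ≠ 0 → c j = c i + 1) (hg : 0 < g) (hdg : d ∣ g)
    (hv : ∀ x, CritReach F 1 (v x) (v (x + 1))) (hper : ∀ x, v (s + g + x) = v (s + x)) (u : ℕ) :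
    RowStable F (v 0) (s + u + g * (Nat.card {x // c x = c (v (s + u))} - 1)) := by
  have h1 : CritReach F (s + u) (v 0) (v (s + u)) := by
    simpa using CritReach.of_seq hF hv 0 (s + u)
  refine RowStable.transfer hF h1 (RowStable.of_cycle hF hd hc hdg hg (CritReach.self hd (s := g) ?_))
  have h2 := CritReach.of_seq hF hv (s + u) g
  rwa [one_mul, show s + u + g = s + g + u by ring, hper] at h2

/-- A critical cycle that runs through all nodes of a colour class. -/
theorem RowStable.of_lasso_hamiltonian (hF : IsPowerFamily F) (hd : ∀ t i, F t i i ≤ 1)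
    (hc : ∀ i j, F 1 i j ≠ 0 → c j = c i + 1) {q : ℕ} (hd0 : 0 < d) (hq : 2 ≤ q)
    (hg : g = d * q) (hv : ∀ x, CritReach F 1 (v x) (v (x + 1)))
    (hper : ∀ x, v (s + g + x) = v (s + x)) (hinj : Set.InjOn v (Set.Iio (s + g)))
    (hcol : ∀ x, c (v x) = c (v 0) + x)
    {u : ℕ} (hu : u < d) (hcard : Nat.card {x // c x = c (v (s + u))} = q) :
    RowStable F (v 0) (s + u + d * ((q - 1) ^ 2 + 1)) := by
  classical
  have : NeZero q := ⟨by omega⟩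
  have : Fact (1 < q) := ⟨by omega⟩
  have h1 : CritReach F (s + u) (v 0) (v (s + u)) := by
    simpa using CritReach.of_seq hF hv 0 (s + u)
  refine RowStable.transfer hF h1 (RowStable.of_restrict hF hc dvd_rfl hd0 ?_)
  have hperm : ∀ m y, v (s + u + d * (y + q * m)) = v (s + u + d * y) := by
    intro m y
    induction m with
    | zero => simp
    | succ m ih =>
      rw [← ih, show s + u + d * (y + q * (m + 1)) = s + g + (u + d * (y + q * m)) by
        rw [hg]; ring, hper, add_assoc]
  have hmem : ∀ y, c (v (s + u + d * y)) = c (v (s + u)) := by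
    intro y
    rw [hcol, hcol (s + u)]
    simp
  -- Every `d`-th node of the cycle lies in the class, and there are as many of them as the class
  -- has nodes.
  let z : ZMod q → {x // c x = c (v (s + u))} := fun x => ⟨v (s + u + d * x.val), hmem _⟩
  have hzinj : Function.Injective z := by
    intro x y hxy
    have hxy' : v (s + u + d * x.val) = v (s + u + d * y.val) := congrArg Subtype.val hxy
    have hlt : ∀ x : ZMod q, s + u + d * x.val < s + g := by
      intro x
      have h2 : d * (x.val + 1) ≤ d * q := Nat.mul_le_mul_left _ (ZMod.val_lt x)
      rw [mul_add, mul_one] at h2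
      omega
    have h3 := hinj (hlt x) (hlt y) hxy'
    exact ZMod.val_injective q (Nat.eq_of_mul_eq_mul_left hd0 (by omega))
  have hzbij : Function.Bijective z := by
    rw [Fintype.bijective_iff_injective_and_card, ZMod.card, ← Nat.card_eq_fintype_card, hcard]
    exact ⟨hzinj, rfl⟩
  refine RowStable.of_hamiltonian (hF.restrict hc dvd_rfl _) (fun t i => hd _ _) hq hzbij ?_ _
  intro x
  have hz1 : (z (x + 1) : V) = v (s + u + d * x.val + d) := by
    change v (s + u + d * (x + 1).val) = _
    rw [ZMod.val_add, ZMod.val_one, ← hperm ((x.val + 1) / q), Nat.mod_add_div, mul_add, mul_one,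
      ← add_assoc]
  obtain ⟨r, hr, h⟩ := CritReach.of_seq hF hv (s + u + d * x.val) d
  rw [one_mul, ← hz1] at h
  -- The return walk joins nodes of equal colour, so its length is a multiple of `d` and it survives
  -- in the restricted family.
  have hne : F r (z (x + 1)) (v (s + u + d * x.val)) ≠ 0 := by
    intro h0
    simp [h0] at h
  have hcr := hF.color_eq hc hne
  rw [(z (x + 1)).2, hmem, left_eq_add, ZMod.natCast_eq_zero_iff] at hcr
  obtain ⟨r', rfl⟩ := hcr
  exact ⟨r', Nat.pos_of_mul_pos_left hr, by simpa using h⟩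

end Core

end MaxAlg

namespace MaxAlg

/-! ### Sizes of the colour classes along a lasso -/

section Counting

open Finset

variable {V : Type*} [Fintype V] {d : ℕ} {c : V → ZMod d} {v : ℕ → V} {s g : ℕ}

theorem lasso_card_le (hinj : Set.InjOn v (Set.Iio (s + g))) : s + g ≤ Fintype.card V := by
  classical
  have h := ((range (s + g)).image v).card_le_univ
  rwa [card_image_of_injOn (by simpa using hinj), card_range] at h

/-- A colour class contains at least the average number of nodes of the cycle. -/
theorem cycle_le_mul_card_class (hd0 : 0 < d) (hdg : d ∣ g)
    (hinj : Set.InjOn v (Set.Iio (s + g))) (hcol : ∀ x, c (v x) = c (v 0) + x)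
    {u : ℕ} (hu : u < d) : g ≤ d * Nat.card {x // c x = c (v (s + u))} := by
  classical
  obtain ⟨m, rfl⟩ := hdg
  refine Nat.mul_le_mul_left _ ?_
  rw [Nat.card_eq_fintype_card, Fintype.card_subtype, ← card_range m]
  have hlt : ∀ x < m, s + u + d * x < s + d * m := by
    intro x hx
    have h2 : d * (x + 1) ≤ d * m := Nat.mul_le_mul_left _ hx
    rw [mul_add, mul_one] at h2
    omega
  refine card_le_card_of_injOn (fun x => v (s + u + d * x)) ?_ ?_
  · intro x _
    simp [hcol (s + u + d * x), hcol (s + u)]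
  · intro x hx y hy hxy
    have h := hinj (hlt x (by simpa using hx)) (hlt y (by simpa using hy)) hxy
    exact Nat.eq_of_mul_eq_mul_left hd0 (by omega)

/-- The colour classes are numbered by `0, …, d - 1` and partition the nodes. -/
theorem sum_card_class (hd0 : 0 < d) (hcol : ∀ x, c (v x) = c (v 0) + x) :
    ∑ u ∈ range d, Nat.card {x // c x = c (v (s + u))} = Fintype.card V := by
  classical
  have : NeZero d := ⟨hd0.ne'⟩
  rw [← card_univ, card_eq_sum_card_fiberwise (f := fun x => (c x - c (v s)).val)
    (t := range d) (fun x _ => by simpa using ZMod.val_lt _)]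
  refine sum_congr rfl fun u hu => ?_
  rw [Nat.card_eq_fintype_card, Fintype.card_subtype]
  congr 1
  ext x
  simp only [mem_filter, mem_univ, true_and]
  have hv : c (v (s + u)) = c (v s) + u := by
    rw [hcol, hcol s]; push_cast; ring
  rw [hv, ← sub_eq_iff_eq_add']
  constructor
  · intro h
    rw [h, ZMod.val_natCast_of_lt (mem_range.1 hu)]
  · intro h
    rw [← h, ZMod.natCast_zmod_val]

/-- If the first `u` colour classes met on the cycle are larger than the next one, each of them has
a node off the lasso. -/
theorem lasso_add_le (hdg : d ∣ g) (hinj : Set.InjOn v (Set.Iio (s + g)))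
    (hcol : ∀ x, c (v x) = c (v 0) + x) {u : ℕ} (hu : u < d)
    (hlarge : ∀ j < u, Nat.card {x // c x = c (v (s + u))} <
      Nat.card {x // c x = c (v (s + j))}) : s + g + u ≤ Fintype.card V := by
  classical
  have hex : ∀ j, ∃ y, j < u → c y = c (v (s + j)) ∧ y ∉ (range (s + g)).image v := by
    intro j
    by_cases hj : j < u
    swap
    · exact ⟨v 0, fun h => absurd h hj⟩
    have hlt := hlarge j hj
    simp only [Nat.card_eq_fintype_card, Fintype.card_subtype] at hlt
    by_contra! hcon
    -- If the `j`-th class lay wholly on the lasso, a shift by u - j along the lasso would inject it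
    -- into the smaller `u`-th class.
    have hcov : univ.filter (fun x => c x = c (v (s + j))) ⊆
        ((range (s + g)).filter fun x => c (v x) = c (v (s + j))).image v := by
      intro y hy
      obtain ⟨-, hy⟩ := mem_filter.1 hy
      obtain ⟨x, hx, rfl⟩ := mem_image.1 ((hcon y).2 hy)
      exact mem_image_of_mem _ (mem_filter.2 ⟨hx, hy⟩)
    have hshift : ∀ x ∈ (range (s + g)).filter fun x => c (v x) = c (v (s + j)),
        x + (u - j) < s + g := by
      intro x hx
      obtain ⟨hx, hcx⟩ := mem_filter.1 hx
      have hx := mem_range.1 hx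
      by_contra! hge
      -- If the shift left the lasso, this multiple of `d` would lie strictly between 0 and `d`.
      have hdvd : d ∣ s + g + j - x := by
        rw [← ZMod.natCast_eq_zero_iff, Nat.cast_sub (by omega)]
        rw [hcol, hcol (s + j), add_right_inj] at hcx
        rw [hcx]
        push_cast
        rw [(ZMod.natCast_eq_zero_iff g d).2 hdg]
        ring
      have := Nat.le_of_dvd (by omega) hdvd
      omega
    have hle : #((range (s + g)).filter fun x => c (v x) = c (v (s + j))) ≤
        #(univ.filter fun x => c x = c (v (s + u))) := by
      refine card_le_card_of_injOn (fun x => v (x + (u - j))) ?_ ?_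
      · intro x hx
        have hcx := (mem_filter.1 hx).2
        simp only [coe_filter, mem_univ, true_and, Set.mem_ofPred_eq]
        rw [hcol, hcol (s + j), add_right_inj] at hcx
        rw [hcol, hcol (s + u)]
        push_cast [Nat.cast_sub hj.le, hcx]
        ring
      · intro x hx y hy hxy
        have := hinj (hshift x hx) (hshift y hy) hxy
        omega
    have := (card_le_card hcov).trans (card_image_le.trans hle)
    omega
  choose y hy using hex
  have hyinj : Set.InjOn y (range u : Set ℕ) := by
    intro i hi j hj hij
    have hi := mem_range.1 hi
    have hj := mem_range.1 hj
    have h := (hy i hi).1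
    rw [hij, (hy j hj).1, hcol, hcol (s + i), add_right_inj] at h
    push_cast at h
    rw [add_right_inj, ZMod.natCast_eq_natCast_iff] at h
    exact (Nat.ModEq.eq_of_lt_of_lt h (by omega) (by omega)).symm
  have hdisj : Disjoint ((range (s + g)).image v) ((range u).image y) := by
    rw [disjoint_right]
    intro a ha
    obtain ⟨j, hj, rfl⟩ := mem_image.1 ha
    exact (hy j (mem_range.1 hj)).2
  have h := (((range (s + g)).image v) ∪ ((range u).image y)).card_le_univ
  rwa [card_union_of_disjoint hdisj, card_image_of_injOn (by simpa using hinj),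
    card_image_of_injOn hyinj, card_range, card_range] at h

/-- Either some colour class is smaller than average, or after at most `n % d` steps along the
cycle one meets a class of average size. -/
theorem exists_small_class (hd0 : 0 < d) (hdg : d ∣ g) (hinj : Set.InjOn v (Set.Iio (s + g)))
    (hcol : ∀ x, c (v x) = c (v 0) + x) :
    (∃ u < d, Nat.card {x // c x = c (v (s + u))} < Fintype.card V / d) ∨
    ∃ u < d, Nat.card {x // c x = c (v (s + u))} = Fintype.card V / d ∧
      u ≤ Fintype.card V % d ∧ s + g + u ≤ Fintype.card V := by
  classical
  set n := Fintype.card V with hn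
  set N : ℕ → ℕ := fun u => Nat.card {x // c x = c (v (s + u))} with hN
  have hsum : ∑ u ∈ range d, N u = n := sum_card_class hd0 hcol
  by_cases hsmall : ∃ u < d, N u < n / d
  · exact Or.inl hsmall
  right
  push Not at hsmall
  have hdiv := Nat.div_add_mod n d
  have hmod := Nat.mod_lt n hd0
  have hex : ∃ u, u < d ∧ N u ≤ n / d := by
    by_contra! hcon
    have h := card_nsmul_le_sum (range d) N (n / d + 1) fun u hu => hcon u (mem_range.1 hu)
    rw [hsum, card_range, smul_eq_mul, mul_add, mul_one] at h
    omega
  set u := Nat.find hex with hu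
  obtain ⟨hud, huN⟩ := Nat.find_spec hex
  have hNu : N u = n / d := le_antisymm huN (hsmall u hud)
  have hlarge : ∀ j < u, N u < N j := by
    intro j hj
    have h := Nat.find_min hex hj
    rw [not_and, not_le] at h
    rw [hNu]
    exact h (hj.trans hud)
  refine ⟨u, hud, hNu, ?_, lasso_add_le hdg hinj hcol hud hlarge⟩
  -- Each of the first `u` classes exceeds `n / d`; the excess, at least `u` in all, cannot exceed
  -- the remainder.
  have h : ∑ j ∈ range d, (n / d + if j < u then 1 else 0) ≤ ∑ j ∈ range d, N j := by
    refine sum_le_sum fun j hj => ?_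
    split_ifs with hju
    · have := hlarge j hju
      omega
    · simpa using hsmall j (mem_range.1 hj)
  have hfil : (range d).filter (fun j => j < u) = range u := by
    ext j
    simp only [mem_filter, mem_range]
    omega
  rw [hsum, sum_add_distrib, sum_const, card_range, smul_eq_mul, sum_boole, hfil, card_range,
    Nat.cast_id] at h
  omega

/-- The bounds of Schwarz and Kim for a row from which a lasso of critical edges starts. -/
theorem exists_rowStable_of_lasso {F : ℕ → V → V → ℝ≥0} (hF : IsPowerFamily F)
    (hd : ∀ t i, F t i i ≤ 1) (hc : ∀ i j, F 1 i j ≠ 0 → c j = c i + 1) (hd0 : 0 < d)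
    (hg : 0 < g) (hv : ∀ x, CritReach F 1 (v x) (v (x + 1)))
    (hper : ∀ x, v (s + g + x) = v (s + x)) (hinj : Set.InjOn v (Set.Iio (s + g))) {h : ℕ}
    (hh : s + g ≤ h) :
    (∃ t, RowStable F (v 0) t ∧
      t ≤ d * wielandt (Fintype.card V / d) + Fintype.card V % d) ∧
    ∃ t, RowStable F (v 0) t ∧ (t : ℤ) ≤ (((Fintype.card V / d : ℕ) : ℤ) - 2) * (g : ℤ) +
      ((min (Fintype.card V) (h + Fintype.card V % d) : ℕ) : ℤ) := by
  have hcol : ∀ x, c (v x) = c (v 0) + x := by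
    intro x
    induction x with
    | zero => simp
    | succ x ih =>
      obtain ⟨r, -, hr⟩ := hv x
      have hne : F 1 (v x) (v (x + 1)) ≠ 0 := by
        intro h0
        simp [h0] at hr
      rw [hc _ _ hne, ih]
      push_cast
      ring
  have hdg : d ∣ g := by
    have h1 := congrArg c (hper 0)
    rw [hcol, hcol (s + 0), add_right_inj] at h1
    push_cast at h1
    rw [← ZMod.natCast_eq_zero_iff]
    simpa using h1
  have hdg' := Nat.le_of_dvd hg hdg
  have hn := lasso_card_le hinj
  have hsm := exists_small_class hd0 hdg hinj hcol
  have hstab := RowStable.of_lasso hF hd hc hg hdg hv hper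
  have hcyc := fun u (hu : u < d) => cycle_le_mul_card_class hd0 hdg hinj hcol hu
  have hham := fun q (hq : 2 ≤ q) (hgq : g = d * q) u (hu : u < d) =>
    RowStable.of_lasso_hamiltonian hF hd hc hd0 hq hgq hv hper hinj hcol hu
  have hdiv := Nat.div_add_mod (Fintype.card V) d
  have hmod := Nat.mod_lt (Fintype.card V) hd0
  generalize Fintype.card V = n at *
  generalize n / d = q at *
  generalize n % d = r at *
  have hpos : ∀ u < d, 1 ≤ Nat.card {x // c x = c (v (s + u))} := by
    intro u hu
    by_contra! h0
    have := hcyc u hu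
    rw [show Nat.card {x // c x = c (v (s + u))} = 0 by omega] at this
    omega
  -- the bound of Schwarz follows from that of Kim if the cycle is short
  have hshort : g ≤ d * (q - 1) → ∀ t : ℕ,
      (t : ℤ) ≤ ((q : ℤ) - 2) * (g : ℤ) + ((min n (h + r) : ℕ) : ℤ) →
      t ≤ d * wielandt q + r := by
    intro hgq t ht
    obtain ⟨p, rfl⟩ : ∃ p, q = p + 2 := by
      refine ⟨q - 2, ?_⟩
      by_contra hne
      rw [show q - 1 = 0 by omega] at hgq
      omega
    have hmin : ((min n (h + r) : ℕ) : ℤ) ≤ n := by exact_mod_cast min_le_left _ _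
    have h1 : p * g ≤ p * (d * (p + 1)) := Nat.mul_le_mul_left _ hgq
    have h2 : t ≤ p * g + n := by
      zify
      push_cast at ht hmin
      linarith
    rw [wielandt, if_neg (by omega), show p + 2 - 1 = p + 1 by omega]
    calc t ≤ p * g + n := h2
      _ ≤ p * (d * (p + 1)) + (d * (p + 2) + r) := by omega
      _ = _ := by ring
  rcases hsm with ⟨u, hu, hsm⟩ | ⟨u, hu, hsm, hur, hun⟩
  · have h1 := hpos u hu
    obtain ⟨p, rfl⟩ : ∃ p, q = p + 2 := ⟨q - 2, by omega⟩
    have hkim : ((s + u + g * (Nat.card {x // c x = c (v (s + u))} - 1) : ℕ) : ℤ) ≤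
        (((p + 2 : ℕ) : ℤ) - 2) * (g : ℤ) + ((min n (h + r) : ℕ) : ℤ) := by
      have h2 : g * (Nat.card {x // c x = c (v (s + u))} - 1) ≤ g * p :=
        Nat.mul_le_mul_left _ (by omega)
      -- Here u < d ≤ g, so the room s + g on the lasso covers s + u.
      have h3 : s + u ≤ min n (h + r) := by omega
      have h4 : s + u + g * (Nat.card {x // c x = c (v (s + u))} - 1) ≤ p * g + min n (h + r) := by
        rw [mul_comm p g]; omega
      zify at h4
      push_cast at h4 ⊢
      linarith
    refine ⟨⟨_, hstab u, hshort ?_ _ hkim⟩, _, hstab u, hkim⟩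
    exact (hcyc u hu).trans (Nat.mul_le_mul_left _ (by omega))
  · have h1 := hpos u hu
    have hcu := hcyc u hu
    obtain ⟨p, rfl⟩ : ∃ p, q = p + 1 := ⟨q - 1, by omega⟩
    have hkim : ((s + u + g * (Nat.card {x // c x = c (v (s + u))} - 1) : ℕ) : ℤ) ≤
        (((p + 1 : ℕ) : ℤ) - 2) * (g : ℤ) + ((min n (h + r) : ℕ) : ℤ) := by
      rw [hsm, Nat.add_sub_cancel]
      have h3 : s + u + g ≤ min n (h + r) := by omega
      zify at h3
      push_cast at h3 ⊢
      linarith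
    refine ⟨?_, _, hstab u, hkim⟩
    by_cases hgq : g ≤ d * (p + 1 - 1)
    · exact ⟨_, hstab u, hshort hgq _ hkim⟩
    have hgeq : g = d * (p + 1) := by
      obtain ⟨m, rfl⟩ := hdg
      rw [hsm] at hcu
      have h2 := Nat.le_of_mul_le_mul_left hcu hd0
      have h3 : p < m := by
        by_contra! hle
        exact hgq (Nat.mul_le_mul_left _ (by omega))
      rw [show m = p + 1 by omega]
    -- The cycle uses up dq of the n = dq + r nodes, and s + g + u ≤ n.
    have hsr : s + u ≤ r := by omega
    rcases Nat.eq_zero_or_pos p with rfl | hp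
    · refine ⟨_, hstab u, ?_⟩
      rw [hsm]
      simp [wielandt, hsr]
    · refine ⟨_, hham (p + 1) (by omega) hgeq u hu hsm, ?_⟩
      rw [wielandt, if_neg (by omega)]
      omega

end Counting

end MaxAlg

/-! ### Walks and cycles as relations and periodic sequences -/

namespace Digraph

variable {V : Type*} {D : Digraph V}

theorem reaches_iff {i j : V} : D.Reaches i j ↔ Relation.ReflTransGen D.Adj i j := by
  constructor
  · rintro ⟨t, w, hw, rfl, rfl⟩
    have h : ∀ s : Fin (t + 1), Relation.ReflTransGen D.Adj (w 0) (w s) := by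
      intro s
      induction s using Fin.induction with
      | zero => exact .refl
      | succ s ih => exact ih.tail (hw s)
    exact h _
  · intro h
    induction h with
    | refl => exact ⟨0, fun _ => i, fun s => s.elim0, rfl, rfl⟩
    | @tail l j _ hlj ih =>
      obtain ⟨t, w, hw, h0, hl⟩ := ih
      refine ⟨t + 1, Fin.snoc w j, fun s => ?_, ?_, by simp⟩
      · induction s using Fin.lastCases with
        | last =>
          rw [Fin.snoc_castSucc, Fin.succ_last, Fin.snoc_last, hl]
          exact hlj
        | cast s =>
          rw [Fin.snoc_castSucc, Fin.succ_castSucc, Fin.snoc_castSucc]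
          exact hw s
      · rw [← Fin.castSucc_zero, Fin.snoc_castSucc, h0]

/-- A cycle as a periodic sequence. -/
theorem IsCycle.exists_periodic {t : ℕ} {w : Fin (t + 1) → V} (hw : D.IsCycle w) :
    ∃ z : ℕ → V, (∀ x, D.Adj (z x) (z (x + 1))) ∧ (∀ x, z (x + t) = z x) ∧
      Set.InjOn z (Set.Iio t) ∧ ∀ s : Fin (t + 1), w s = z s := by
  obtain ⟨ht, hadj, hclosed, hinj⟩ := hw
  have hlt : ∀ x, x % t < t := fun x => Nat.mod_lt x ht
  have hwz : ∀ s : Fin (t + 1), w s = w (Fin.castSucc ⟨s % t, hlt s⟩) := by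
    intro s
    induction s using Fin.lastCases with
    | last =>
      rw [← hclosed]
      congr 1
      ext
      simp
    | cast s =>
      congr 1
      ext
      simp [Nat.mod_eq_of_lt s.2]
  refine ⟨fun x => w (Fin.castSucc ⟨x % t, hlt x⟩), fun x => ?_, fun x => ?_, ?_, hwz⟩
  · have h := hadj ⟨x % t, hlt x⟩
    rw [hwz (Fin.succ _)] at h
    simpa using h
  · simp
  · intro x hx y hy hxy
    have h := congrArg Fin.val (hinj hxy)
    simpa [Nat.mod_eq_of_lt hx, Nat.mod_eq_of_lt hy] using h

end Digraph

/-! ### From matrices to power families -/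

namespace MaxAlg

variable {n : ℕ} {A : Matrix (Fin n) (Fin n) ℝ≥0}

theorem exists_pow_succ_eq (A : Matrix (Fin n) (Fin n) ℝ≥0) (t : ℕ) (i j : Fin n) :
    ∃ l, pow A (t + 1) i j = pow A t i l * A l j := by
  obtain ⟨l, -, hl⟩ := Finset.exists_mem_eq_sup (Finset.univ : Finset (Fin n)) ⟨i, Finset.mem_univ i⟩
    fun l => pow A t i l * A l j
  exact ⟨l, hl⟩

theorem le_pow_succ (A : Matrix (Fin n) (Fin n) ℝ≥0) (t : ℕ) (i l j : Fin n) :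
    pow A t i l * A l j ≤ pow A (t + 1) i j :=
  Finset.le_sup (f := fun l => pow A t i l * A l j) (Finset.mem_univ l)

theorem isPowerFamily_pow (A : Matrix (Fin n) (Fin n) ℝ≥0) :
    IsPowerFamily fun t i j => pow A t i j where
  zero_self i := Matrix.one_apply_eq i
  zero_ne i j h := Matrix.one_apply_ne h
  mul_le s t i l j := by
    induction t generalizing j with
    | zero =>
      by_cases h : l = j
      · subst h
        simp [pow]
      · simp [pow, Matrix.one_apply_ne h]
    | succ t ih =>
      obtain ⟨m, hm⟩ := exists_pow_succ_eq A t l j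
      rw [hm, ← mul_assoc]
      exact (mul_le_mul' (ih m) le_rfl).trans (le_pow_succ A (s + t) i m j)
  exists_le s t i j := by
    induction t generalizing j with
    | zero => exact ⟨j, by simp [pow]⟩
    | succ t ih =>
      obtain ⟨m, hm⟩ := exists_pow_succ_eq A (s + t) i j
      obtain ⟨l, hl⟩ := ih m
      refine ⟨l, ?_⟩
      rw [← add_assoc, hm]
      refine (mul_le_mul' hl le_rfl).trans ?_
      rw [mul_assoc]
      exact mul_le_mul' le_rfl (le_pow_succ A t l m j)

theorem pow_one_apply (A : Matrix (Fin n) (Fin n) ℝ≥0) (i j : Fin n) : pow A 1 i j = A i j := by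
  apply le_antisymm
  · obtain ⟨l, hl⟩ := exists_pow_succ_eq A 0 i j
    rw [zero_add] at hl
    rw [hl]
    by_cases h : i = l
    · subst h
      simp [pow]
    · simp [pow, Matrix.one_apply_ne h]
  · simpa [pow] using le_pow_succ A 0 i i j

theorem exists_pow_ne_zero {i j : Fin n} (h : (digraph A).Reaches i j) : ∃ t, pow A t i j ≠ 0 := by
  rw [Digraph.reaches_iff] at h
  induction h with
  | refl => exact ⟨0, by simp [pow]⟩
  | @tail l j _ hlj ih =>
    obtain ⟨t, ht⟩ := ih
    exact ⟨t + 1, ((pos_iff_ne_zero.2 (mul_ne_zero ht hlj)).trans_le (le_pow_succ A t i l j)).ne'⟩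

/-! ### Closed walks -/

theorem geomMean_pow {t : ℕ} (ht : 0 < t) (w : Fin (t + 1) → Fin n) :
    geomMean A w ^ t = weight A w := by
  rw [geomMean, one_div]
  exact NNReal.rpow_inv_natCast_pow _ ht.ne'

/-- Cycles have length at most `n`, so only finitely many means occur and the supremum is a genuine
one. -/
theorem geomMean_le_maxCycleMean {t : ℕ} {w : Fin (t + 1) → Fin n} (hw : (digraph A).IsCycle w) :
    geomMean A w ≤ maxCycleMean A := by
  refine le_csSup (Set.Finite.bddAbove ?_) ⟨t, w, hw, rfl⟩
  refine ((Set.finite_Iic n).biUnion fun t _ =>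
    Set.finite_range fun w : Fin (t + 1) → Fin n => geomMean A w).subset ?_
  rintro _ ⟨t, w, hw, rfl⟩
  have h := Fintype.card_le_of_injective _ hw.2.2.2
  simp only [Fintype.card_fin] at h
  exact Set.mem_biUnion (Set.mem_Iic.2 h) ⟨w, rfl⟩

/-- Closed walks decompose into cycles. -/
theorem pow_self_le {d : ℕ} (hdvd : ∀ t ∈ (digraph A).cycleLengths, d ∣ t) {t : ℕ} {i : Fin n}
    (h : pow A t i i ≠ 0) : pow A t i i ≤ maxCycleMean A ^ t ∧ d ∣ t := by
  have hP := isPowerFamily_pow A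
  induction t using Nat.strong_induction_on generalizing i with
  | _ t ih =>
    rcases Nat.eq_zero_or_pos t with rfl | ht
    · simp [pow]
    obtain ⟨w, h0, hwt, hw⟩ := hP.exists_walk h
    by_cases hinj : Set.InjOn w (Set.Iio t)
    · have hne : ∀ s ∈ Finset.range t, pow A 1 (w s) (w (s + 1)) ≠ 0 := by
        rw [← Finset.prod_ne_zero_iff]
        exact ((pos_iff_ne_zero.2 h).trans_le hw).ne'
      have hcyc : (digraph A).IsCycle fun s : Fin (t + 1) => w s := by
        refine ⟨ht, fun s => ?_, by simp [h0, hwt], fun x y hxy => ?_⟩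
        · have := hne s (Finset.mem_range.2 s.2)
          rw [pow_one_apply] at this
          simpa [digraph] using this
        · exact Fin.ext (hinj x.2 y.2 (by simpa using hxy))
      refine ⟨?_, hdvd t ⟨_, hcyc⟩⟩
      calc pow A t i i ≤ _ := hw
        _ = weight A fun s : Fin (t + 1) => w s := by
          rw [weight, Finset.prod_range]
          simp [pow_one_apply]
        _ = _ := (geomMean_pow ht _).symm
        _ ≤ _ := pow_le_pow_left' (geomMean_le_maxCycleMean hcyc) t
    -- A repeated node splits the walk into two shorter closed walks; both the weight bound and the
    -- divisibility are inherited.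
    · obtain ⟨a, b, hab, hb, hwab⟩ : ∃ a b, a < b ∧ b < t ∧ w a = w b := by
        simp only [Set.InjOn, not_forall] at hinj
        obtain ⟨a, ha, b, hb, hwab, hne⟩ := hinj
        rcases lt_or_gt_of_ne hne with hlt | hlt
        · exact ⟨a, b, hlt, hb, hwab⟩
        · exact ⟨b, a, hlt, ha, hwab.symm⟩
      have h1 := hw.trans (hP.prod_range_le w hab.le hb.le)
      rw [h0, hwt, ← hwab, mul_right_comm] at h1
      have h2 := h1.trans (mul_le_mul' (hP.mul_le _ _ _ _ _) le_rfl)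
      have hne := mul_ne_zero_iff.1 ((pos_iff_ne_zero.2 h).trans_le h2).ne'
      obtain ⟨h3, h4⟩ := ih _ (by omega) hne.1
      obtain ⟨h5, h6⟩ := ih _ (by omega) hne.2
      have ht' : t = a + (t - b) + (b - a) := by omega
      refine ⟨h2.trans ((mul_le_mul' h3 h5).trans_eq ?_), ?_⟩
      · rw [← _root_.pow_add, ← ht']
      · rw [ht']
        exact dvd_add h4 h6

/-! ### The normalized powers -/

/-- The powers of `A` divided by those of `λ(A)`. -/
noncomputable def normPow (A : Matrix (Fin n) (Fin n) ℝ≥0) (t : ℕ) (i j : Fin n) : ℝ≥0 :=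
  pow A t i j / maxCycleMean A ^ t

theorem isPowerFamily_normPow (hA : maxCycleMean A ≠ 0) : IsPowerFamily (normPow A) where
  zero_self i := by simp [normPow, pow]
  zero_ne i j h := by simp [normPow, pow, Matrix.one_apply_ne h]
  mul_le s t i l j := by
    rw [normPow, normPow, normPow, div_mul_div_comm, ← _root_.pow_add]
    gcongr
    exact (isPowerFamily_pow A).mul_le s t i l j
  exists_le s t i j := by
    obtain ⟨l, hl⟩ := (isPowerFamily_pow A).exists_le s t i j
    refine ⟨l, ?_⟩
    rw [normPow, normPow, normPow, div_mul_div_comm, ← _root_.pow_add]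
    gcongr

theorem normPow_self_le (t : ℕ) (i : Fin n) : normPow A t i i ≤ 1 := by
  by_cases h : pow A t i i = 0
  · simp [normPow, h]
  · exact div_le_one_of_le₀ (pow_self_le (d := 1) (fun _ _ => one_dvd _) h).1 zero_le

/-- The rest of a critical cycle through the edge is the return walk that completes weight 1. -/
theorem critReach_of_adj (hA : maxCycleMean A ≠ 0) {i j : Fin n}
    (h : (criticalGraph A).Adj i j) : CritReach (normPow A) 1 i j := by
  obtain ⟨t, w, ⟨hcyc, hcrit⟩, s, rfl, rfl⟩ := h
  have hP := isPowerFamily_pow A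
  have hF := isPowerFamily_normPow hA
  obtain ⟨z, -, hper, -, hz⟩ := hcyc.exists_periodic
  have ht := hcyc.1
  have hs := s.2
  have hz1 : w s.castSucc = z s := hz _
  have hz2 : w s.succ = z (s + 1) := hz _
  have hw : maxCycleMean A ^ t ≤ pow A 1 (z s) (z (s + 1)) * pow A (t - 1) (z (s + 1)) (z s) := by
    calc maxCycleMean A ^ t = ∏ x ∈ Finset.range t, pow A 1 (z x) (z (x + 1)) := by
          rw [← hcrit, geomMean_pow ht, weight, Finset.prod_range]
          simp [pow_one_apply, hz]
      _ ≤ _ := hP.prod_range_le z (Nat.le_succ s) hs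
      _ = pow A 1 (z s) (z (s + 1)) *
          (pow A (t - (s + 1)) (z (s + 1)) (z 0) * pow A s (z 0) (z s)) := by
          rw [show z t = z 0 by simpa using hper 0, Nat.succ_eq_add_one, Nat.add_sub_cancel_left]
          ring
      _ ≤ _ := by
          refine mul_le_mul' le_rfl ((hP.mul_le _ _ _ _ _).trans_eq ?_)
          congr 1
          omega
  rw [hz1, hz2]
  have h1 : 1 ≤ normPow A 1 (z s) (z (s + 1)) * normPow A (t - 1) (z (s + 1)) (z s) := by
    rw [normPow, normPow, div_mul_div_comm, ← _root_.pow_add, Nat.add_sub_cancel' ht,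
      one_le_div₀ (pow_pos (pos_iff_ne_zero.2 hA) t)]
    exact hw
  have h2 : 1 ≤ normPow A (1 + (t - 1)) (z s) (z s) := h1.trans (hF.mul_le _ _ _ _ _)
  -- One further turn keeps the return length positive when the critical cycle is a loop.
  refine ⟨t - 1 + (1 + (t - 1)), by omega, ?_⟩
  calc 1 ≤ _ := h1
    _ ≤ _ := mul_le_mul' le_rfl ((le_mul_of_one_le_right zero_le h2).trans (hF.mul_le _ _ _ _ _))

theorem maxCycleMean_ne_zero {k : Fin n} (hk : IsCriticalNode A k) : maxCycleMean A ≠ 0 := by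
  obtain ⟨t, w, ⟨hcyc, hcrit⟩, -⟩ := hk
  rw [← hcrit]
  intro h0
  have h := geomMean_pow (A := A) hcyc.1 w
  rw [h0, zero_pow hcyc.1.ne', weight] at h
  obtain ⟨s, -, hs⟩ := Finset.prod_eq_zero_iff.1 h.symm
  exact hcyc.2.1 s hs

/-! ### The component of the critical graph -/

/-- A shortest cycle of the component of the critical graph that contains `k`. -/
theorem exists_critical_cycle {k : Fin n} (hk : IsCriticalNode A k) :
    ∃ z : ℕ → Fin n, 0 < criticalGirth A k ∧ (∀ x, (criticalGraph A).Adj (z x) (z (x + 1))) ∧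
      (∀ x, z (x + criticalGirth A k) = z x) ∧ Set.InjOn z (Set.Iio (criticalGirth A k)) ∧
      Relation.ReflTransGen (criticalGraph A).Adj k (z 0) ∧
      Relation.ReflTransGen (criticalGraph A).Adj (z 0) k := by
  -- Needed for the girth, an infimum in ℕ, to be attained by a cycle.
  have hne : ((criticalGraph A).component k).cycleLengths.Nonempty := by
    obtain ⟨t, w, hw, s, hs⟩ := hk
    have hadj : (criticalGraph A).IsWalk w := fun s => ⟨t, w, hw, s, rfl, rfl⟩
    have hcyc : (criticalGraph A).IsCycle w := ⟨hw.1.1, hadj, hw.1.2.2⟩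
    obtain ⟨z, hz, hper, -, hwz⟩ := hcyc.exists_periodic
    have hmem : ∀ x, w x ∈ (criticalGraph A).componentNodes k := by
      intro x
      rw [Digraph.componentNodes, Set.mem_ofPred_eq, Digraph.reaches_iff, Digraph.reaches_iff, ← hs,
        hwz, hwz]
      exact ⟨reflTransGen_of_cycle hcyc.1 hz hper _ _, reflTransGen_of_cycle hcyc.1 hz hper _ _⟩
    exact ⟨t, w, hcyc.1, fun x => ⟨hmem _, hmem _, hadj x⟩, hcyc.2.2⟩
  obtain ⟨w, hw⟩ : criticalGirth A k ∈ ((criticalGraph A).component k).cycleLengths :=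
    Nat.sInf_mem hne
  obtain ⟨z, hz, hper, hinj, -⟩ := hw.exists_periodic
  have h0 := (hz 0).1
  rw [Digraph.componentNodes, Set.mem_ofPred_eq, Digraph.reaches_iff, Digraph.reaches_iff] at h0
  exact ⟨z, hw.1, fun x => (hz x).2.2, hper, hinj, h0⟩

theorem criticalSize_eq (k : Fin n) : criticalSize A k =
    {x | Relation.ReflTransGen (criticalGraph A).Adj k x ∧
      Relation.ReflTransGen (criticalGraph A).Adj x k}.ncard := by
  simp only [criticalSize, Digraph.componentNodes, Digraph.reaches_iff]

variable {d : ℕ} {c : Fin n → ZMod d}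

/-- The bounds of Schwarz and Kim for rows, given a colouring. -/
theorem exists_rowStable {k : Fin n} (hk : IsCriticalNode A k) (hd0 : 0 < d)
    (hc : ∀ i j, A i j ≠ 0 → c j = c i + 1) :
    (∃ t, RowStable (normPow A) k t ∧ t ≤ d * wielandt (n / d) + n % d) ∧
    ∃ t, RowStable (normPow A) k t ∧ (t : ℤ) ≤ (((n / d : ℕ) : ℤ) - 2) * (criticalGirth A k : ℤ) +
      ((min n (criticalSize A k + n % d) : ℕ) : ℤ) := by
  have hA := maxCycleMean_ne_zero hk
  obtain ⟨z, hg, hz, hper, hinj, hkz, hzk⟩ := exists_critical_cycle hk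
  obtain ⟨v, s, rfl, hv, hvper, hvinj, hcard⟩ := exists_lasso hg hz hper hinj hkz hzk
  rw [← criticalSize_eq] at hcard
  simpa using exists_rowStable_of_lasso (isPowerFamily_normPow hA) normPow_self_le
    (fun i j h => hc i j fun h0 => h (by simp [normPow, pow_one_apply, h0])) hd0 hg
    (fun x => critReach_of_adj hA (hv x)) hvper hvinj hcard

/-- The bounds of Schwarz and Kim for columns, given a colouring. -/
theorem exists_colStable {k : Fin n} (hk : IsCriticalNode A k) (hd0 : 0 < d)
    (hc : ∀ i j, A i j ≠ 0 → c j = c i + 1) :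
    (∃ t, RowStable (fun t i j => normPow A t j i) k t ∧ t ≤ d * wielandt (n / d) + n % d) ∧
    ∃ t, RowStable (fun t i j => normPow A t j i) k t ∧
      (t : ℤ) ≤ (((n / d : ℕ) : ℤ) - 2) * (criticalGirth A k : ℤ) +
        ((min n (criticalSize A k + n % d) : ℕ) : ℤ) := by
  have hA := maxCycleMean_ne_zero hk
  obtain ⟨z, hg, hz, hper, hinj, hkz, hzk⟩ := exists_critical_cycle hk
  have hsize := criticalSize_eq (A := A) k
  generalize criticalGirth A k = g at *
  -- Modulo g + 1, multiplication by `g` is negation, so `z (g * x)` reverses the cycle without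
  -- subtraction.
  obtain ⟨g, rfl⟩ : ∃ g', g = g' + 1 := ⟨g - 1, by omega⟩
  -- the cycle, traversed backwards
  have hz' : ∀ x, Function.swap (criticalGraph A).Adj (z (g * x)) (z (g * (x + 1))) := by
    intro x
    have h := hz (g * (x + 1))
    rwa [show g * (x + 1) + 1 = g * x + (g + 1) by ring, hper] at h
  have hper' : ∀ x, z (g * (x + (g + 1))) = z (g * x) := by
    intro x
    rw [mul_add, cycle_add_mul hper]
  have hmod : ∀ x, z (x % (g + 1)) = z x := by
    intro x
    conv_rhs => rw [← Nat.mod_add_div' x (g + 1)]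
    exact (cycle_add_mul hper _ _).symm
  have hinj' : Set.InjOn (fun x => z (g * x)) (Set.Iio (g + 1)) := by
    intro x hx y hy hxy
    dsimp only at hxy
    rw [← hmod (g * x), ← hmod (g * y)] at hxy
    have h : g * x ≡ g * y [MOD g + 1] := hinj (Nat.mod_lt _ hg) (Nat.mod_lt _ hg) hxy
    exact Nat.ModEq.eq_of_lt_of_lt (h.cancel_left_of_coprime (by simp)) hx hy
  obtain ⟨v, s, rfl, hv, hvper, hvinj, hcard⟩ := exists_lasso
    (E := Function.swap (criticalGraph A).Adj) (k := k) (z := fun x => z (g * x)) hg hz' hper' hinj'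
    (Relation.reflTransGen_swap.2 (by simpa using hzk))
    (Relation.reflTransGen_swap.2 (by simpa using hkz))
  simp only [Relation.reflTransGen_swap] at hcard
  simp only [and_comm] at hcard hsize
  rw [← hsize] at hcard
  -- Reversing the edges negates the colouring.
  simpa using exists_rowStable_of_lasso (c := fun i => -c i) (isPowerFamily_normPow hA).flip
    (fun t i => normPow_self_le t i)
    (fun i j h => by
      rw [hc j i fun h0 => h (by simp [normPow, pow_one_apply, h0])]
      ring) hd0 hg
    (fun x => (critReach_of_adj hA (hv x)).flip) hvper hvinj hcard

/-! ### Cyclic classes of an irreducible matrix -/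

/-- The colour of `j` is the length of a chosen walk from `k` to `j`. Completing the walks to `i`
(plus the edge) and to `j` by the same return to `k` gives closed walks, whose lengths are multiples
of the cyclicity. -/
theorem exists_coloring (hA : IsIrreducible A) (k : Fin n) :
    ∃ c : Fin n → ZMod (digraph A).cyclicity, ∀ i j, A i j ≠ 0 → c j = c i + 1 := by
  have hP := isPowerFamily_pow A
  have hdvd : ∀ t i, pow A t i i ≠ 0 → (t : ZMod (digraph A).cyclicity) = 0 := fun t i h =>
    (ZMod.natCast_eq_zero_iff _ _).2 (pow_self_le (fun _ ht => Nat.setGcd_dvd_of_mem ht) h).2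
  have hmul : ∀ {s t i l j}, pow A s i l ≠ 0 → pow A t l j ≠ 0 → pow A (s + t) i j ≠ 0 :=
    fun h h' => ((pos_iff_ne_zero.2 (mul_ne_zero h h')).trans_le (hP.mul_le _ _ _ _ _)).ne'
  choose τ hτ using fun j => exists_pow_ne_zero (hA k j)
  refine ⟨fun j => τ j, fun i j hij => ?_⟩
  rw [← pow_one_apply A] at hij
  obtain ⟨r, hr⟩ := exists_pow_ne_zero (hA j k)
  have h1 := hdvd _ _ (hmul (hτ j) hr)
  have h2 := hdvd _ _ (hmul (hmul (hτ i) hij) hr)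
  push_cast at h1 h2
  linear_combination h1 - h2

theorem cyclicity_pos {k : Fin n} (hk : IsCriticalNode A k) : 0 < (digraph A).cyclicity := by
  obtain ⟨t, w, ⟨hcyc, -⟩, -⟩ := hk
  exact Nat.pos_of_dvd_of_pos (Nat.setGcd_dvd_of_mem (s := (digraph A).cycleLengths) ⟨w, hcyc⟩)
    hcyc.1

theorem normPow_eq_iff (hA : maxCycleMean A ≠ 0) {p t : ℕ} {i j : Fin n} :
    normPow A (p + t) i j = normPow A t i j ↔
      pow A (p + t) i j = maxCycleMean A ^ p * pow A t i j := by
  have h1 := pow_ne_zero p hA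
  have h2 := pow_ne_zero t hA
  rw [normPow, normPow, _root_.pow_add, div_eq_div_iff (mul_ne_zero h1 h2) h2,
    show pow A t i j * (maxCycleMean A ^ p * maxCycleMean A ^ t) =
      maxCycleMean A ^ p * pow A t i j * maxCycleMean A ^ t by ring]
  exact mul_left_inj' h2

/-- The bounds for a set of stability times give those for its least element. -/
theorem exists_isLeast_bounds {k : Fin n} (hk : IsCriticalNode A k) {S : Set ℕ}
    (hS : ∀ d : ℕ, 0 < d → (∃ c : Fin n → ZMod d, ∀ i j, A i j ≠ 0 → c j = c i + 1) →
      (∃ t ∈ S, t ≤ d * wielandt (n / d) + n % d) ∧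
      ∃ t ∈ S, (t : ℤ) ≤ (((n / d : ℕ) : ℤ) - 2) * (criticalGirth A k : ℤ) +
        ((min n (criticalSize A k + n % d) : ℕ) : ℤ)) :
    ∃ T, IsLeast S T ∧ WielandtDMBounds A k T ∧ (IsIrreducible A → SchwarzKimBounds A k T) := by
  -- With one colour every matrix is coloured; this gives the bounds that do not need
  -- irreducibility.
  obtain ⟨⟨t, ht, htle⟩, t', ht', htle'⟩ := hS 1 one_pos
    ⟨fun _ => 0, fun _ _ _ => Subsingleton.elim _ _⟩
  refine ⟨sInf S, ⟨Nat.sInf_mem ⟨t, ht⟩, fun _ => Nat.sInf_le⟩, ⟨?_, ?_⟩, fun hirr => ?_⟩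
  · have := Nat.sInf_le ht
    simp only [Nat.div_one, Nat.mod_one] at htle
    omega
  · have h1 : ((sInf S : ℕ) : ℤ) ≤ t' := by exact_mod_cast Nat.sInf_le ht'
    have h2 : ((min n (criticalSize A k + n % 1) : ℕ) : ℤ) ≤ criticalSize A k := by
      rw [Nat.mod_one, add_zero]
      exact_mod_cast min_le_right _ _
    rw [Nat.div_one] at htle'
    linarith
  · obtain ⟨⟨t, ht, htle⟩, t', ht', htle'⟩ := hS _ (cyclicity_pos hk) (exists_coloring hirr k)
    refine ⟨(Nat.sInf_le ht).trans htle, le_trans ?_ htle'⟩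
    exact_mod_cast Nat.sInf_le ht'

end MaxAlg

theorem theorem1 {n : ℕ} (A : Matrix (Fin n) (Fin n) ℝ≥0) (k : Fin n)
    (hk : MaxAlg.IsCriticalNode A k) :
    (∃ T : ℕ, MaxAlg.IsRowTransient A k T ∧ MaxAlg.WielandtDMBounds A k T ∧
      (MaxAlg.IsIrreducible A → MaxAlg.SchwarzKimBounds A k T)) ∧
    (∃ T : ℕ, MaxAlg.IsColTransient A k T ∧ MaxAlg.WielandtDMBounds A k T ∧
      (MaxAlg.IsIrreducible A → MaxAlg.SchwarzKimBounds A k T)) := by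
  have hA := MaxAlg.maxCycleMean_ne_zero hk
  constructor
  · refine MaxAlg.exists_isLeast_bounds hk fun d hd ⟨c, hc⟩ => ?_
    simpa only [Set.mem_ofPred_eq, MaxAlg.RowStable, MaxAlg.normPow_eq_iff hA] using MaxAlg.exists_rowStable hk hd hc
  · refine MaxAlg.exists_isLeast_bounds hk fun d hd ⟨c, hc⟩ => ?_
    simpa only [Set.mem_ofPred_eq, MaxAlg.RowStable, MaxAlg.normPow_eq_iff hA] using MaxAlg.exists_colStable hk hd hc
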